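/- Setting. For every $n$ let $\mathbf M=\mathbf M_n\in\mathbb R^{n\times n}$ be a (deterministic) symmetric matrix, let $\mathbf E=\mathbf E_n$ be a symmetric $n\times n$ random matrix, and let $\hat{\mathbf M}=\mathbf M+\mathbf E$. For all large $n$, $\mathbf M$ has rank $k=k_n\ge1$. Let $\sigma_1\ge\dots\ge\sigma_k>0$ be the leading singular values of $\mathbf M$, let $\psi=|\lambda_1/\lambda_k|$ be the ratio of the largest to the smallest modulus of the nonzero eigenvalues of $\mathbf M$, and let $S_n=\|\mathbf M\|$ (spectral norm). For nonnegative sequences write $a_n\lesssim b_n$ if there is a constant $c$ not depending on $n$ with $a_n\le c\,b_n$ for all but finitely many $n$. Assume that there are a constant $\beta_\Delta>0$ and quantities $E_n>0$ such that $S_n/E_n\gtrsim n^{\beta_\Delta}$ and, for all large $n$, $\mathbb P[\|\mathbf E\|\le E_n]\ge1-n^{-6}$; assume also $\psi=o(S_n/E_n)$. Algorithm (rs-RSVD). Given $\tilde k\ge k$ and integers $a_n,g\ge1$, let $\mathbf G_1,\dots,\mathbf G_{a_n}\in\mathbb R^{n\times\tilde k}$ be independent matrices with i.i.d. standard normal entries,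 independent of $\mathbf E$. Choose $\tilde a$ maximizing the $k$-th largest singular value of $\hat{\mathbf M}^g\mathbf G_a$ over $a\le a_n$, let $\hat{\mathbf U}_g\in\mathbb R^{n\times k}$ have as columns orthonormal left singular vectors of $\hat{\mathbf M}^g\mathbf G_{\tilde a}$ for its $k$ leading singular values, and let $\tilde\sigma_1\ge\dots\ge\tilde\sigma_k$ be the singular values of $\hat{\mathbf U}_g^\top\hat{\mathbf M}$ (ties being broken arbitrarily). Put $\vartheta=\max\{1,\tilde k^{-1/2}\log^{1/2}n\}$. Claim. There are positive constants $C_a(k,\tilde k)$, depending only on $k,\tilde k$; $C_b\le15$, universal; and $C_c(c_{\rm gap})$, depending only on $c_{\rm gap}$ and nonincreasing in $c_{\rm gap}>1$, such that the following holds in the setting above. Suppose that one of the following conditions holds, with $a_n\ge\lceil C\tilde k^{-1}\log n\rceil$ for all large $n$: (a) $k$ and $\tilde k$ are both fixed, and $C=C_a(k,\tilde k)$; (b) $k$ is fixed, $\tilde k\to\infty$ as $n\to\infty$, and $C=C_b$; (c) $k\to\infty$ as $n\to\infty$, $\tilde k\ge c_{\rm gap}k$ for a fixed $c_{\rm gap}>1$,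 and $C=C_c(c_{\rm gap})$. Then for every fixed integer $g\ge1+(2\beta_\Delta)^{-1}$, $$\max_{1\le\ell\le k}|\tilde\sigma_\ell-\sigma_\ell|\;\lesssim\;\vartheta\,\psi^g\,E_n\qquad\text{with probability at least }1-n^{-5},$$ that is, there is a constant $K$ not depending on $n$ such that for all large $n$, with probability at least $1-n^{-5}$, the left-hand side is at most $K\vartheta\psi^gE_n$. -/

import Mathlib

open Filter Topology MeasureTheory ProbabilityTheory
open scoped Matrix Matrix.Norms.L2Operator

namespace RSVD

/-- The singular values of a real matrix in decreasing order, numbered from `0` (so the `k`-th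
largest one is `sv A (k - 1)`); the sequence is continued by zeros. -/
noncomputable def sv {m n : ℕ} (A : Matrix (Fin m) (Fin n) ℝ) (i : ℕ) : ℝ :=
  (Matrix.toEuclideanLin A).singularValues i

/-- The condition number `ψ = |λ₁ / λ_k|` of a symmetric matrix of rank `k ≥ 1`: the ratio of the
largest to the smallest modulus of its nonzero eigenvalues. -/
noncomputable def condNumber {n : ℕ} (M : Matrix (Fin n) (Fin n) ℝ) : ℝ :=
  sSup (abs '' (spectrum ℝ M \ {0})) / sInf (abs '' (spectrum ℝ M \ {0}))

/-- The columns of `U` are left singular vectors of `Y` for its `k` leading singular values: they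
are the left part of some system of `k` leading singular triples. Ties may be broken in any way. -/
def IsLeadingLeftSingular {n m k : ℕ} (Y : Matrix (Fin n) (Fin m) ℝ)
    (U : Matrix (Fin n) (Fin k) ℝ) : Prop :=
  Uᵀ * U = 1 ∧ ∃ V : Matrix (Fin m) (Fin k) ℝ, Vᵀ * V = 1 ∧
    Y * V = U * Matrix.diagonal (fun i : Fin k => sv Y i) ∧
    Yᵀ * U = V * Matrix.diagonal (fun i : Fin k => sv Y i)

/-- `(U, σ)` are the singular vectors and singular values returned by rs-RSVD with rank `k` and `g`
power iterations, for the data matrix `Mhat` and the sketching matrices `G 1, …, G a`: a sketch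
`b` maximizing `σ_k (Mhat ^ g * G b)` is selected, `U` consists of `k` leading left singular
vectors of `Mhat ^ g * G b`, and `σ 0 ≥ … ≥ σ (k - 1)` are the singular values of `Uᵀ * Mhat`. -/
def IsRSVDOutput {n kt a k : ℕ} (g : ℕ) (Mhat : Matrix (Fin n) (Fin n) ℝ)
    (G : Fin a → Matrix (Fin n) (Fin kt) ℝ)
    (U : Matrix (Fin n) (Fin k) ℝ) (σ : Fin k → ℝ) : Prop :=
  ∃ b : Fin a,
    (∀ b' : Fin a, sv (Mhat ^ g * G b') (k - 1) ≤ sv (Mhat ^ g * G b) (k - 1)) ∧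
    IsLeadingLeftSingular (Mhat ^ g * G b) U ∧
    ∀ l : Fin k, σ l = sv (Uᵀ * Mhat) l

/-- `u ≲ v`: there is a constant `c` with `u n ≤ c * v n` for all but finitely many `n`. -/
def Precsim (u v : ℕ → ℝ) : Prop :=
  ∃ c : ℝ, ∀ᶠ n in atTop, u n ≤ c * v n

/-- `P` holds with probability at least `p`: it holds on a measurable event of probability at
least `p`. -/
def HoldsWithProb {Ω : Type*} [MeasurableSpace Ω] (μ : Measure Ω) (p : ℝ) (P : Ω → Prop) : Prop :=
  ∃ A : Set Ω, MeasurableSet A ∧ p ≤ μ.real A ∧ ∀ ω ∈ A, P ω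

/-- `X` is a symmetric random matrix. -/
def IsSymmRandomMatrix {Ω : Type*} [MeasurableSpace Ω] {n : ℕ}
    (X : Ω → Matrix (Fin n) (Fin n) ℝ) : Prop :=
  (∀ i j, Measurable fun ω => X ω i j) ∧ ∀ ω, (X ω).IsSymm

/-- `G 1, …, G a` are independent matrices with independent standard normal entries, and they are
independent of the random matrix `X`. -/
def IsGaussianSketch {Ω : Type*} [MeasurableSpace Ω] (μ : Measure Ω) {n kt a : ℕ}
    (X : Ω → Matrix (Fin n) (Fin n) ℝ) (G : Ω → Fin a → Matrix (Fin n) (Fin kt) ℝ) : Prop :=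
  HasLaw (fun ω (q : Fin a × Fin n × Fin kt) => G ω q.1 q.2.1 q.2.2)
    (Measure.pi fun _ => gaussianReal 0 1) μ ∧
  IndepFun (fun ω (p : Fin n × Fin n) => X ω p.1 p.2)
    (fun ω (q : Fin a × Fin n × Fin kt) => G ω q.1 q.2.1 q.2.2) μ

/-- The signal-to-noise ratio assumption with exponent `β`, for signal matrices `M n`, noise
matrices `E n` and noise levels `En n`; here `‖·‖` is the spectral norm. -/
structure SNRAssumption {Ω : ℕ → Type*} [∀ n, MeasurableSpace (Ω n)] (μ : ∀ n, Measure (Ω n))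
    (M : ∀ n, Matrix (Fin n) (Fin n) ℝ) (E : ∀ n, Ω n → Matrix (Fin n) (Fin n) ℝ)
    (En : ℕ → ℝ) (β : ℝ) : Prop where
  beta_pos : 0 < β
  noise_pos : ∀ᶠ n in atTop, 0 < En n
  snr : Precsim (fun n => (n : ℝ) ^ β) (fun n => ‖M n‖ / En n)
  noise : ∀ᶠ n : ℕ in atTop, 1 - (n : ℝ) ^ (-6 : ℤ) ≤ (μ n).real {ω | ‖E n ω‖ ≤ En n}

/-- `a n ≥ ⌈C log n / kt n⌉` for all large `n`. -/
def EnoughSketches (C : ℝ) (kt a : ℕ → ℕ) : Prop :=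
  ∀ᶠ n : ℕ in atTop, ⌈C * (kt n : ℝ)⁻¹ * Real.log n⌉ ≤ (a n : ℤ)

/-- The admissible growth of the rank `k`, the sketching dimension `kt` and the number `a` of
sketches: (a) `k`, `kt` fixed; (b) `k` fixed, `kt → ∞`; (c) `k → ∞` and `kt ≥ c * k` for a fixed
`c > 1`. The constant in the condition on `a` is `Ca k kt`, `Cb`, `Cc c` respectively. -/
def SketchRegime (Ca : ℕ → ℕ → ℝ) (Cb : ℝ) (Cc : ℝ → ℝ) (k kt a : ℕ → ℕ) : Prop :=
  (∃ k₀ kt₀ : ℕ, (∀ᶠ n in atTop, k n = k₀ ∧ kt n = kt₀) ∧ EnoughSketches (Ca k₀ kt₀) kt a) ∨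
  ((∃ k₀ : ℕ, ∀ᶠ n in atTop, k n = k₀) ∧ Tendsto kt atTop atTop ∧ EnoughSketches Cb kt a) ∨
  (∃ c : ℝ, 1 < c ∧ Tendsto k atTop atTop ∧ (∀ᶠ n in atTop, c * (k n : ℝ) ≤ (kt n : ℝ)) ∧
    EnoughSketches (Cc c) kt a)

/-- `ϑ = max {1, kt ^ (-1/2) (log n) ^ (1/2)}`. -/
noncomputable def theta (kt n : ℕ) : ℝ :=
  max 1 ((Real.sqrt kt)⁻¹ * Real.sqrt (Real.log n))

end RSVD

open Module

set_option linter.unusedSectionVars false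

namespace RSVD

/-! ### Min-max characterization of singular values and Weyl's inequality. -/

section SingularValues

variable {E F F' : Type*} [NormedAddCommGroup E] [InnerProductSpace ℝ E] [FiniteDimensional ℝ E]
  [NormedAddCommGroup F] [InnerProductSpace ℝ F] [FiniteDimensional ℝ F]
  [NormedAddCommGroup F'] [InnerProductSpace ℝ F'] [FiniteDimensional ℝ F']

/-! Write `T = M + E`, `e` for the noise level, `σ` for the `k`-th singular value of `M`, and `S =
‖M‖`. The argument has a deterministic half and a Gaussian half.

Deterministic half. On the event `‖E‖ ≤ e`, with `2e < σ`, the spectrum of `T` splits: a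
`k`-dimensional invariant subspace `K` carries the eigenvalues of modulus at least `σ - e`, and on
its orthogonal complement `T` has norm at most `e` (`exists_splitsAt`). Powering sharpens the gap,
so up to an error `e ^ g * ‖G‖` the range of `T ^ g * G` lies in `K`. If the `k`-th singular value
of `T ^ g * G` is at least `t`, the projection onto the orthogonal complement of the columns of `U`
shrinks every vector of `K` by the factor `4 * e ^ g * ‖G‖ / t` (`SplitsAt.norm_apply_le_of_mem`).
Weyl's inequality then gives the error bound `abs_sv_sub_sv_le`.

Gaussian half. The ratio `‖G‖ / t` must be controlled for the selected sketch, and there is no upper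
bound on the number `a` of sketches: with very many of them, some have abnormally large norm. Let `N
= n * m` be the number of entries of one sketch. The largest Frobenius norm is at most of order `√N`
times `growth N a`. The best sketch gains the same factor: dilating a well-conditioned sketch by `t`
costs a Gaussian probability `exp (-4 * N * t ^ 2)`, which `a` independent trials can afford
(`stdNormal_boundedBelowOn_scaled`, `stdNormal_sketch_failure_le`). The growth factors cancel, and a
loss of order `√n` remains whatever `a` is.

This loss is absorbed by the power iteration: `g - 1 ≥ 1 / (2β)` makes `√n * (e / S) ^ (g - 1)`
bounded (`error_le`). The resulting bound is of order `ψ ^ g * e`; the factor `ϑ` enters only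
through `1 ≤ ϑ`. -/

/-- The span of the members of an orthonormal basis with index in `J`. -/
def coordSpan {n : ℕ} (b : OrthonormalBasis (Fin n) ℝ E) (J : Finset (Fin n)) : Submodule ℝ E :=
  Submodule.span ℝ (Set.range fun i : J => b i)

lemma finrank_coordSpan {n : ℕ} (b : OrthonormalBasis (Fin n) ℝ E) (J : Finset (Fin n)) :
    finrank ℝ (coordSpan b J) = J.card := by
  have h : LinearIndependent ℝ (fun i : J => b i) :=
    b.orthonormal.linearIndependent.comp _ Subtype.val_injective
  rw [coordSpan, finrank_span_eq_card h, Fintype.card_coe]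

lemma repr_eq_zero_of_mem_coordSpan {n : ℕ} {b : OrthonormalBasis (Fin n) ℝ E}
    {J : Finset (Fin n)} {x : E} (hx : x ∈ coordSpan b J) {i : Fin n} (hi : i ∉ J) :
    b.repr x i = 0 := by
  induction hx using Submodule.span_induction with
  | mem x h =>
    obtain ⟨j, rfl⟩ := h
    have : (j : Fin n) ≠ i := fun h => hi (h ▸ j.2)
    simp [b.repr_self, this.symm]
  | zero => simp
  | add x y _ _ hx hy => simp [hx, hy]
  | smul c x _ hx => simp [hx]

lemma sum_repr_sq {n : ℕ} (b : OrthonormalBasis (Fin n) ℝ E) (x : E) :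
    ∑ i, b.repr x i ^ 2 = ‖x‖ ^ 2 := by
  rw [← b.repr.norm_map x, EuclideanSpace.real_norm_sq_eq]

lemma norm_sq_apply_eq_sum (T : E →ₗ[ℝ] F) {n : ℕ} (hn : finrank ℝ E = n) (x : E) :
    ‖T x‖ ^ 2 = ∑ i : Fin n, T.singularValues i ^ 2 *
      (T.isSymmetric_adjoint_comp_self.eigenvectorBasis hn).repr x i ^ 2 := by
  set b := T.isSymmetric_adjoint_comp_self.eigenvectorBasis hn
  have h1 : ‖T x‖ ^ 2 = inner ℝ ((LinearMap.adjoint T ∘ₗ T) x) x := by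
    rw [LinearMap.comp_apply, LinearMap.adjoint_inner_left, real_inner_self_eq_norm_sq]
  rw [h1, ← b.repr.inner_map_map, PiLp.inner_apply]
  refine Finset.sum_congr rfl fun i _ => ?_
  rw [T.isSymmetric_adjoint_comp_self.eigenvectorBasis_apply_self_apply hn,
    T.sq_singularValues_fin hn]
  simp only [RCLike.inner_apply, conj_trivial, RCLike.ofReal_real_eq_id, id]
  ring

/-- Courant–Fischer, attained from above. -/
lemma exists_submodule_singularValues_le (T : E →ₗ[ℝ] F) {i : ℕ} (hi : i < finrank ℝ E) :
    ∃ S : Submodule ℝ E, finrank ℝ S = i + 1 ∧ ∀ x ∈ S, T.singularValues i * ‖x‖ ≤ ‖T x‖ := by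
  refine ⟨coordSpan (T.isSymmetric_adjoint_comp_self.eigenvectorBasis rfl)
    (Finset.Iic ⟨i, hi⟩), ?_, fun x hx => ?_⟩
  · rw [finrank_coordSpan]; simp
  · refine abs_le_of_sq_le_sq' ?_ (norm_nonneg _) |>.2
    rw [mul_pow, norm_sq_apply_eq_sum T rfl,
      ← sum_repr_sq (T.isSymmetric_adjoint_comp_self.eigenvectorBasis rfl), Finset.mul_sum]
    refine Finset.sum_le_sum fun j _ => ?_
    by_cases hj : j ∈ Finset.Iic (⟨i, hi⟩ : Fin (finrank ℝ E))
    · have : T.singularValues i ≤ T.singularValues j :=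
        T.singularValues_antitone (by simpa using Fin.le_def.1 (Finset.mem_Iic.1 hj))
      have := T.singularValues_nonneg i
      gcongr
    · rw [repr_eq_zero_of_mem_coordSpan hx hj]; simp

/-- The dual extremal subspace, spanned by the trailing right singular vectors. Beyond the dimension
the zero subspace serves, which lets Weyl's inequality hold for every index. -/
lemma exists_submodule_le_singularValues (T : E →ₗ[ℝ] F) (i : ℕ) :
    ∃ S : Submodule ℝ E, finrank ℝ E ≤ i + finrank ℝ S ∧
      ∀ x ∈ S, ‖T x‖ ≤ T.singularValues i * ‖x‖ := by
  by_cases! hi : finrank ℝ E ≤ i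
  · exact ⟨⊥, by omega, fun x hx => by simp [(Submodule.mem_bot ℝ).1 hx]⟩
  refine ⟨coordSpan (T.isSymmetric_adjoint_comp_self.eigenvectorBasis rfl)
    (Finset.Ici ⟨i, hi⟩), ?_, fun x hx => ?_⟩
  · rw [finrank_coordSpan]; simp; omega
  · have h0 := T.singularValues_nonneg i
    refine abs_le_of_sq_le_sq' ?_ (by positivity) |>.2
    rw [mul_pow, norm_sq_apply_eq_sum T rfl,
      ← sum_repr_sq (T.isSymmetric_adjoint_comp_self.eigenvectorBasis rfl), Finset.mul_sum]
    refine Finset.sum_le_sum fun j _ => ?_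
    by_cases hj : j ∈ Finset.Ici (⟨i, hi⟩ : Fin (finrank ℝ E))
    · have h1 : T.singularValues j ≤ T.singularValues i :=
        T.singularValues_antitone (by simpa using Fin.le_def.1 (Finset.mem_Ici.1 hj))
      have := T.singularValues_nonneg j
      gcongr
    · rw [repr_eq_zero_of_mem_coordSpan hx hj]; simp

/-- The dimension count behind the min-max comparisons. -/
lemma exists_ne_zero_mem_inf {S S' : Submodule ℝ E}
    (h : finrank ℝ E < finrank ℝ S + finrank ℝ S') : ∃ x ∈ S, x ∈ S' ∧ x ≠ 0 := by
  have h1 := Submodule.finrank_sup_add_finrank_inf_eq S S'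
  have h2 := Submodule.finrank_le (S ⊔ S')
  have h3 : S ⊓ S' ≠ ⊥ := by
    intro hb
    rw [hb, finrank_bot] at h1
    omega
  obtain ⟨x, hx, hx0⟩ := Submodule.exists_mem_ne_zero_of_ne_bot h3
  exact ⟨x, hx.1, hx.2, hx0⟩

lemma le_singularValues_of_submodule (T : E →ₗ[ℝ] F) {i : ℕ} {c : ℝ} (S : Submodule ℝ E)
    (hS : i < finrank ℝ S) (h : ∀ x ∈ S, c * ‖x‖ ≤ ‖T x‖) : c ≤ T.singularValues i := by
  obtain ⟨S', hS', h'⟩ := exists_submodule_le_singularValues T i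
  obtain ⟨x, hx, hx', hx0⟩ := exists_ne_zero_mem_inf (S := S) (S' := S') (by omega)
  exact le_of_mul_le_mul_right ((h x hx).trans (h' x hx')) (norm_pos_iff.2 hx0)

lemma singularValues_le_of_submodule (T : E →ₗ[ℝ] F) {i : ℕ} {c : ℝ} (hc : 0 ≤ c)
    (S : Submodule ℝ E) (hS : finrank ℝ E ≤ i + finrank ℝ S) (h : ∀ x ∈ S, ‖T x‖ ≤ c * ‖x‖) :
    T.singularValues i ≤ c := by
  by_cases! hi : finrank ℝ E ≤ i
  · rwa [T.singularValues_of_finrank_le hi]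
  obtain ⟨S', hS', h'⟩ := exists_submodule_singularValues_le T hi
  obtain ⟨x, hx, hx', hx0⟩ := exists_ne_zero_mem_inf (S := S) (S' := S') (by omega)
  exact le_of_mul_le_mul_right ((h' x hx').trans (h x hx)) (norm_pos_iff.2 hx0)

/-- Weyl's inequality. -/
lemma singularValues_le_add (T : E →ₗ[ℝ] F) (T' : E →ₗ[ℝ] F') {c : ℝ} (hc : 0 ≤ c)
    (h : ∀ x, ‖T x‖ ≤ ‖T' x‖ + c * ‖x‖) (i : ℕ) :
    T.singularValues i ≤ T'.singularValues i + c := by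
  obtain ⟨S, hS, h'⟩ := exists_submodule_le_singularValues T' i
  refine singularValues_le_of_submodule T (add_nonneg (T'.singularValues_nonneg i) hc) S hS
    fun x hx => ?_
  rw [add_mul]
  exact (h x).trans (by gcongr; exact h' x hx)

lemma norm_apply_le_singularValues_zero (T : E →ₗ[ℝ] F) (x : E) :
    ‖T x‖ ≤ T.singularValues 0 * ‖x‖ := by
  obtain ⟨S, hS, h⟩ := exists_submodule_le_singularValues T 0
  have : S = ⊤ := Submodule.eq_top_of_finrank_eq (le_antisymm (Submodule.finrank_le S) (by simpa using hS))
  exact h x (this ▸ Submodule.mem_top)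

end SingularValues

/-! ### Spectral gap of a perturbed low-rank operator, and sketches of its powers. -/

section SpectralSplitting

variable {E F : Type*} [NormedAddCommGroup E] [InnerProductSpace ℝ E] [FiniteDimensional ℝ E]
  [NormedAddCommGroup F] [InnerProductSpace ℝ F] [FiniteDimensional ℝ F]

lemma norm_sq_apply_eq_sum_eigenvalues {T : E →ₗ[ℝ] E} (hT : T.IsSymmetric) {n : ℕ}
    (hn : finrank ℝ E = n) (x : E) :
    ‖T x‖ ^ 2 = ∑ i : Fin n, hT.eigenvalues hn i ^ 2 * (hT.eigenvectorBasis hn).repr x i ^ 2 := by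
  rw [← sum_repr_sq (hT.eigenvectorBasis hn)]
  refine Finset.sum_congr rfl fun i _ => ?_
  rw [hT.eigenvectorBasis_apply_self_apply hn]
  simp [mul_pow]

/-- `K` splits `T` into a part that is bounded below by `τ` and a part bounded above by `e`. -/
structure SplitsAt (T : E →ₗ[ℝ] E) (K : Submodule ℝ E) (τ e : ℝ) : Prop where
  map_mem : ∀ x ∈ K, T x ∈ K
  map_mem_orthogonal : ∀ x ∈ Kᗮ, T x ∈ Kᗮ
  le_norm : ∀ x ∈ K, τ * ‖x‖ ≤ ‖T x‖
  norm_le : ∀ x ∈ Kᗮ, ‖T x‖ ≤ e * ‖x‖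

/-- The operator `N` is bounded below by its `k`-th singular value on a `k`-dimensional space and
vanishes on a space of codimension `k`. Intersecting these with spans of eigenvectors of `T` shows
that at least `k` eigenvalues have modulus at least `τ` and at most `k` have modulus above `e`.
Since `e < τ`, the two index sets coincide, so no modulus falls strictly between. -/
lemma exists_splitsAt {T N : E →ₗ[ℝ] E} (hT : T.IsSymmetric) {k : ℕ} {e : ℝ} (hk : 1 ≤ k)
    (hN : finrank ℝ (LinearMap.range N) = k) (h : ∀ x, ‖T x - N x‖ ≤ e * ‖x‖)
    (he : 2 * e < N.singularValues (k - 1)) (he0 : 0 ≤ e) :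
    ∃ K : Submodule ℝ E, finrank ℝ K = k ∧ SplitsAt T K (N.singularValues (k - 1) - e) e := by
  set τ := N.singularValues (k - 1) - e with hτ
  have hτe : e < τ := by rw [hτ]; linarith
  have hkn : k ≤ finrank ℝ E := hN ▸ LinearMap.finrank_range_le N
  set b := hT.eigenvectorBasis rfl
  set J : Finset (Fin (finrank ℝ E)) := {i | τ ≤ |hT.eigenvalues rfl i|}
  have hJm : ∀ i, i ∈ J ↔ τ ≤ |hT.eigenvalues rfl i| := fun i => by simp [J]
  set J' : Finset (Fin (finrank ℝ E)) := {i | e < |hT.eigenvalues rfl i|}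
  have hJm' : ∀ i, i ∈ J' ↔ e < |hT.eigenvalues rfl i| := fun i => by simp [J']
  have hsub : J ⊆ J' := fun i hi => (hJm' i).2 (hτe.trans_le ((hJm i).1 hi))
  have strict : ∀ (I : Finset (Fin (finrank ℝ E))) (c : ℝ), 0 ≤ c →
      (∀ i ∈ I, |hT.eigenvalues rfl i| < c) → ∀ x ∈ coordSpan b I, x ≠ 0 →
      ‖T x‖ < c * ‖x‖ := by
    intro I c hc hI x hx hx0
    refine abs_lt_of_sq_lt_sq' ?_ (by positivity) |>.2
    rw [mul_pow, norm_sq_apply_eq_sum_eigenvalues hT rfl, ← sum_repr_sq b, Finset.mul_sum]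
    have hne : ∃ i, b.repr x i ≠ 0 := by
      by_contra! hcon
      exact hx0 (b.repr.map_eq_zero_iff.1 (by ext i; simpa using hcon i))
    have key : ∀ i, b.repr x i ≠ 0 → hT.eigenvalues rfl i ^ 2 < c ^ 2 := fun i hi => by
      have : i ∈ I := by
        by_contra hcon
        exact hi (repr_eq_zero_of_mem_coordSpan hx hcon)
      exact sq_lt_sq' (abs_lt.1 (hI i this)).1 (abs_lt.1 (hI i this)).2
    refine Finset.sum_lt_sum (fun i _ => ?_) ?_
    · by_cases hi : b.repr x i = 0
      · simp [b, hi]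
      · exact mul_le_mul_of_nonneg_right (key i hi).le (sq_nonneg _)
    · obtain ⟨i, hi⟩ := hne
      exact ⟨i, Finset.mem_univ _, mul_lt_mul_of_pos_right (key i hi) (by positivity)⟩
  have lower : ∀ (I : Finset (Fin (finrank ℝ E))) (c : ℝ), 0 ≤ c →
      (∀ i ∈ I, c ≤ |hT.eigenvalues rfl i|) → ∀ x ∈ coordSpan b I, c * ‖x‖ ≤ ‖T x‖ := by
    intro I c hc hI x hx
    refine abs_le_of_sq_le_sq' ?_ (norm_nonneg _) |>.2
    rw [mul_pow, norm_sq_apply_eq_sum_eigenvalues hT rfl, ← sum_repr_sq b, Finset.mul_sum]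
    refine Finset.sum_le_sum fun i _ => ?_
    by_cases hi : i ∈ I
    · rw [← sq_abs (hT.eigenvalues rfl i)]
      exact mul_le_mul_of_nonneg_right (pow_le_pow_left₀ hc (hI i hi) 2) (sq_nonneg _)
    · rw [repr_eq_zero_of_mem_coordSpan hx hi]; simp
  have upper : ∀ (I : Finset (Fin (finrank ℝ E))) (c : ℝ), 0 ≤ c →
      (∀ i ∈ I, |hT.eigenvalues rfl i| ≤ c) → ∀ x ∈ coordSpan b I, ‖T x‖ ≤ c * ‖x‖ := by
    intro I c hc hI x hx
    refine abs_le_of_sq_le_sq' ?_ (by positivity) |>.2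
    rw [mul_pow, norm_sq_apply_eq_sum_eigenvalues hT rfl, ← sum_repr_sq b, Finset.mul_sum]
    refine Finset.sum_le_sum fun i _ => ?_
    by_cases hi : i ∈ I
    · rw [← sq_abs (hT.eigenvalues rfl i)]
      exact mul_le_mul_of_nonneg_right (pow_le_pow_left₀ (abs_nonneg _) (hI i hi) 2) (sq_nonneg _)
    · rw [repr_eq_zero_of_mem_coordSpan hx hi]; simp
  have card1 : k ≤ J.card := by
    by_contra! hlt
    obtain ⟨S, hS, hS'⟩ := exists_submodule_singularValues_le N (i := k - 1) (by omega)
    have hc : finrank ℝ (coordSpan b Jᶜ) = finrank ℝ E - J.card := by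
      rw [finrank_coordSpan, Finset.card_compl, Fintype.card_fin]
    obtain ⟨x, hx, hx', hx0⟩ := exists_ne_zero_mem_inf (S := S) (S' := coordSpan b Jᶜ) (by omega)
    have h1 := strict Jᶜ τ (he0.trans hτe.le)
      (fun i hi => not_le.1 fun hc => Finset.mem_compl.1 hi ((hJm i).2 hc)) x hx' hx0
    have h2 := hS' x hx
    have h3 := norm_sub_norm_le (N x) (T x)
    rw [norm_sub_rev] at h3
    have h4 := h x
    rw [hτ, sub_mul] at h1
    linarith
  have card2 : J'.card ≤ k := by
    by_contra! hlt
    have hker := N.finrank_range_add_finrank_ker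
    obtain ⟨x, hx, hx', hx0⟩ := exists_ne_zero_mem_inf (S := LinearMap.ker N)
      (S' := coordSpan b J') (by rw [finrank_coordSpan]; omega)
    have h4 := h x
    rw [LinearMap.mem_ker.1 hx, sub_zero] at h4
    have hmin : ∃ c, e < c ∧ ∀ i ∈ J', c ≤ |hT.eigenvalues rfl i| := by
      obtain ⟨i0, hi0, hmin⟩ := Finset.exists_min_image J' (fun i => |hT.eigenvalues rfl i|)
        (Finset.card_pos.1 (by omega))
      exact ⟨_, (hJm' i0).1 hi0, hmin⟩
    obtain ⟨c, hec, hc⟩ := hmin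
    have h5 := lower J' c (he0.trans hec.le) hc x hx'
    have : e * ‖x‖ < c * ‖x‖ := mul_lt_mul_of_pos_right hec (norm_pos_iff.2 hx0)
    linarith
  have hJJ : J = J' := Finset.eq_of_subset_of_card_le hsub (by omega)
  have hcard : J.card = k := le_antisymm (by rw [hJJ]; exact card2) card1
  have hmap : ∀ x ∈ coordSpan b J, T x ∈ coordSpan b J := by
    intro x hx
    induction hx using Submodule.span_induction with
    | mem x h =>
      obtain ⟨j, rfl⟩ := h
      simp only [b]
      rw [hT.apply_eigenvectorBasis rfl]
      exact Submodule.smul_mem _ _ (Submodule.subset_span ⟨j, rfl⟩)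
    | zero => simp
    | add x y _ _ hx hy => rw [map_add]; exact Submodule.add_mem _ hx hy
    | smul c x _ hx => rw [map_smul]; exact Submodule.smul_mem _ _ hx
  have horth : ∀ x ∈ (coordSpan b J)ᗮ, x ∈ coordSpan b Jᶜ := by
    intro x hx
    rw [← b.sum_repr x]
    refine Submodule.sum_mem _ fun i _ => ?_
    by_cases hi : i ∈ J
    · have : b.repr x i = 0 := by
        rw [b.repr_apply_apply]
        exact hx _ (Submodule.subset_span ⟨⟨i, hi⟩, rfl⟩)
      rw [this]; simp
    · exact Submodule.smul_mem _ _ (Submodule.subset_span ⟨⟨i, Finset.mem_compl.2 hi⟩, rfl⟩)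
  refine ⟨coordSpan b J, by rw [finrank_coordSpan, hcard], hmap, fun x hx y hy => ?_, ?_, ?_⟩
  · rw [← hT y x]
    exact hx _ (hmap y hy)
  · exact lower J τ (he0.trans hτe.le) fun i hi => (hJm i).1 hi
  · exact fun x hx => upper Jᶜ e he0
      (fun i hi => not_lt.1 fun hc => Finset.mem_compl.1 hi (hJJ ▸ (hJm' i).2 hc)) x (horth x hx)

namespace SplitsAt

variable {T : E →ₗ[ℝ] E} {K : Submodule ℝ E} {τ e : ℝ}

lemma pow (h : SplitsAt T K τ e) (hτ : 0 ≤ τ) (he : 0 ≤ e) (g : ℕ) :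
    SplitsAt (T ^ g) K (τ ^ g) (e ^ g) := by
  induction g with
  | zero => exact ⟨by simp, by simp, by simp, by simp⟩
  | succ g ih =>
    simp only [pow_succ']
    refine ⟨fun x hx => h.map_mem _ (ih.map_mem x hx),
      fun x hx => h.map_mem_orthogonal _ (ih.map_mem_orthogonal x hx), fun x hx => ?_,
      fun x hx => ?_⟩
    · rw [mul_assoc]
      exact (mul_le_mul_of_nonneg_left (ih.le_norm x hx) hτ).trans
        (h.le_norm _ (ih.map_mem x hx))
    · rw [mul_assoc]
      exact (h.norm_le _ (ih.map_mem_orthogonal x hx)).trans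
        (mul_le_mul_of_nonneg_left (ih.norm_le x hx) he)

lemma starProjection_apply (h : SplitsAt T K τ e) (x : E) :
    K.starProjection (T x) = T (K.starProjection x) := by
  refine Submodule.eq_starProjection_of_mem_of_inner_eq_zero
    (h.map_mem _ (K.starProjection_apply_mem x)) fun w hw => ?_ 
  rw [← map_sub, real_inner_comm]
  exact h.map_mem_orthogonal _ (K.sub_starProjection_mem_orthogonal x) w hw

/-- A lower bound for the singular values of a sketch `T G` of an operator `T`. -/
lemma le_singularValues_comp (h : SplitsAt T K τ e) (hτ : 0 ≤ τ) (G : F →ₗ[ℝ] E) {s : ℝ}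
    (hs : 0 < s) (hG : ∀ x ∈ K, s * ‖x‖ ≤ ‖LinearMap.adjoint G x‖) {i : ℕ}
    (hi : i < finrank ℝ K) : τ * s ≤ (T ∘ₗ G).singularValues i := by
  have hinj : Function.Injective ((LinearMap.adjoint G).domRestrict K) := by
    rw [← LinearMap.ker_eq_bot, LinearMap.ker_eq_bot']
    intro x hx
    have := hG x x.2
    rw [show LinearMap.adjoint G (x : E) = 0 from hx, norm_zero] at this
    have h2 : ‖(x : E)‖ ≤ 0 := nonpos_of_mul_nonpos_right this hs
    simpa using h2
  refine le_singularValues_of_submodule _ (LinearMap.range ((LinearMap.adjoint G).domRestrict K))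
    (by rwa [LinearMap.finrank_range_of_inj hinj]) ?_
  -- The test space is the image of `K` under the adjoint of `G`. For `z = G* y`, pairing the
  -- projection of `G z` with `y` returns `‖z‖ ^ 2`, so `G` followed by the projection onto `K` is
  -- bounded below by `s` there.
  rintro _ ⟨⟨y, hy⟩, rfl⟩
  simp only [LinearMap.domRestrict_apply, LinearMap.comp_apply]
  set z := LinearMap.adjoint G y
  have h1 : ‖z‖ * ‖z‖ ≤ ‖K.starProjection (G z)‖ * ‖y‖ := by
    have e1 : inner ℝ (K.starProjection (G z)) y = ‖z‖ * ‖z‖ := by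
      rw [Submodule.inner_starProjection_left_eq_right, K.starProjection_eq_self_iff.2 hy,
        ← LinearMap.adjoint_inner_right, real_inner_self_eq_norm_mul_norm]
    rw [← e1]
    exact real_inner_le_norm _ _
  have h2 : s * ‖z‖ ≤ ‖K.starProjection (G z)‖ := by
    rcases eq_or_ne y 0 with rfl | hy0
    · simp [z]
    · refine le_of_mul_le_mul_right (le_trans ?_ h1) (norm_pos_iff.2 hy0)
      have := mul_le_mul_of_nonneg_left (hG y hy) (norm_nonneg z)
      nlinarith
  calc τ * s * ‖z‖ ≤ τ * ‖K.starProjection (G z)‖ := by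
        rw [mul_assoc]; exact mul_le_mul_of_nonneg_left h2 hτ
    _ ≤ ‖T (K.starProjection (G z))‖ := h.le_norm _ (K.starProjection_apply_mem _)
    _ = ‖K.starProjection (T (G z))‖ := by rw [h.starProjection_apply]
    _ ≤ ‖T (G z)‖ := K.norm_starProjection_apply_le _

/-- If the `k`-th singular value of the sketch `T G` is at least `t`, then the directions that the
leading left singular vectors of `T G` miss make a small angle with `Kᗮ`. -/
lemma norm_apply_le_of_mem (h : SplitsAt T K τ e) (he : 0 ≤ e) (G : F →ₗ[ℝ] E) {B t : ℝ}
    (hB : 0 ≤ B) (ht : 0 < t) (hG : ∀ z, ‖G z‖ ≤ B * ‖z‖) {k : ℕ} (hk : 1 ≤ k)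
    (hkK : finrank ℝ K = k) (hsv : t ≤ (T ∘ₗ G).singularValues (k - 1)) (Q : E →ₗ[ℝ] E)
    (hQ : ∀ x, ‖Q x‖ ≤ ‖x‖)
    (hQY : ∀ z, ‖Q (T (G z))‖ ≤ (T ∘ₗ G).singularValues k * ‖z‖) {w : E} (hw : w ∈ K) :
    ‖Q w‖ ≤ 4 * (e * B) / t * ‖w‖ := by
  have hζ0 : 0 ≤ e * B := by positivity
  -- In this case the claimed factor exceeds `2` and contractivity of `Q` suffices.
  by_cases! hζ : t / 2 < e * B
  · calc ‖Q w‖ ≤ 1 * ‖w‖ := by simpa using hQ w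
      _ ≤ _ := by
        gcongr
        rw [le_div_iff₀ ht]; linarith
  have hZ : ∀ z, ‖T (G z) - K.starProjection (T (G z))‖ ≤ e * B * ‖z‖ := by
    intro z
    rw [h.starProjection_apply, ← map_sub]
    refine (h.norm_le _ (K.sub_starProjection_mem_orthogonal _)).trans ?_
    rw [mul_assoc]
    refine mul_le_mul_of_nonneg_left (le_trans ?_ (hG z)) he
    rw [← Submodule.starProjection_orthogonal_val]
    exact Kᗮ.norm_starProjection_apply_le _
  let X : F →ₗ[ℝ] K := K.orthogonalProjectionOnto.toLinearMap ∘ₗ T ∘ₗ G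
  have hX : ∀ z, ((X z : K) : E) = K.starProjection (T (G z)) := fun z => rfl
  -- The kernel of `X` has codimension at most `k`, and on it `T G` has only its part in `Kᗮ`.
  have hlast : (T ∘ₗ G).singularValues k ≤ e * B := by
    refine singularValues_le_of_submodule _ hζ0 (LinearMap.ker X) ?_ fun z hz => ?_
    · have h1 := X.finrank_range_add_finrank_ker
      have h2 := Submodule.finrank_le (LinearMap.range X)
      omega
    · have := hZ z
      rwa [← hX, LinearMap.mem_ker.1 hz, Submodule.coe_zero, sub_zero] at this
  have hkF : k - 1 < finrank ℝ F := by
    by_contra! hcon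
    rw [(T ∘ₗ G).singularValues_of_finrank_le hcon] at hsv
    linarith
  obtain ⟨S, hS, hS'⟩ := exists_submodule_singularValues_le (T ∘ₗ G) hkF
  -- On the top `k` right singular directions the component in `K` keeps half the length. Hence `X`
  -- maps `S` bijectively onto `K`, and each `w` in `K` is the projection of some `T (G z)` with `z`
  -- of norm at most `2 * ‖w‖ / t`.
  have hXS : ∀ z ∈ S, t / 2 * ‖z‖ ≤ ‖X z‖ := by
    intro z hz
    have h1 := hS' z hz
    have h2 : t * ‖z‖ ≤ (T ∘ₗ G).singularValues (k - 1) * ‖z‖ := by gcongr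
    have h3 := norm_le_insert' (T (G z)) (K.starProjection (T (G z)))
    have h4 : e * B * ‖z‖ ≤ t / 2 * ‖z‖ := by gcongr
    have h5 := hZ z
    rw [Submodule.coe_norm, hX]
    simp only [LinearMap.comp_apply] at h1
    linarith
  have hinj : Function.Injective (X.domRestrict S) := by
    rw [← LinearMap.ker_eq_bot, LinearMap.ker_eq_bot']
    intro z hz
    have := hXS z z.2
    rw [show X (z : F) = 0 from hz, norm_zero] at this
    have h2 : ‖(z : F)‖ ≤ 0 := nonpos_of_mul_nonpos_right this (by positivity)
    simpa using h2
  have hsurj : Function.Surjective (X.domRestrict S) :=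
    (LinearMap.injective_iff_surjective_of_finrank_eq_finrank (by omega)).1 hinj
  obtain ⟨⟨z, hz⟩, hzw⟩ := hsurj ⟨w, hw⟩
  have hzw' : K.starProjection (T (G z)) = w := by
    rw [← hX]; exact congrArg Subtype.val hzw
  have hzn : t / 2 * ‖z‖ ≤ ‖w‖ := by
    have := hXS z hz
    rwa [Submodule.coe_norm, hX, hzw'] at this
  have hdec : w = T (G z) - (T (G z) - K.starProjection (T (G z))) := by rw [hzw']; abel
  calc ‖Q w‖ = ‖Q (T (G z)) - Q (T (G z) - K.starProjection (T (G z)))‖ := by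
        rw [← map_sub, ← hdec]
    _ ≤ ‖Q (T (G z))‖ + ‖Q (T (G z) - K.starProjection (T (G z)))‖ := norm_sub_le _ _
    _ ≤ e * B * ‖z‖ + e * B * ‖z‖ := by
        refine add_le_add ((hQY z).trans (by gcongr)) ((hQ _).trans (hZ z))
    _ = 4 * (e * B) / t * (t / 2 * ‖z‖) := by field_simp; ring
    _ ≤ _ := by gcongr

end SplitsAt

end SpectralSplitting

/-! ### Passage between matrices and operators on Euclidean space. -/

section MatrixLin

open Matrix (toEuclideanLin)

variable {l m n : ℕ}

lemma norm_toEuclideanLin_le (A : Matrix (Fin m) (Fin n) ℝ) (x : EuclideanSpace ℝ (Fin n)) :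
    ‖toEuclideanLin A x‖ ≤ ‖A‖ * ‖x‖ :=
  Matrix.l2_opNorm_mulVec A x

lemma l2_opNorm_le_of_forall (A : Matrix (Fin m) (Fin n) ℝ) {c : ℝ} (hc : 0 ≤ c)
    (h : ∀ x, ‖toEuclideanLin A x‖ ≤ c * ‖x‖) : ‖A‖ ≤ c := by
  rw [Matrix.l2_opNorm_def]
  exact ContinuousLinearMap.opNorm_le_bound _ hc h

lemma toEuclideanLin_mul_apply (A : Matrix (Fin l) (Fin m) ℝ) (B : Matrix (Fin m) (Fin n) ℝ)
    (x : EuclideanSpace ℝ (Fin n)) :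
    toEuclideanLin (A * B) x = toEuclideanLin A (toEuclideanLin B x) := by
  rw [Matrix.toLpLin_mul_same]; rfl

lemma adjoint_toEuclideanLin (A : Matrix (Fin m) (Fin n) ℝ) :
    LinearMap.adjoint (toEuclideanLin A) = toEuclideanLin Aᵀ := by
  rw [← Matrix.toEuclideanLin_conjTranspose_eq_adjoint, Matrix.conjTranspose_eq_transpose_of_trivial]

lemma inner_toEuclideanLin_left (A : Matrix (Fin m) (Fin n) ℝ) (x : EuclideanSpace ℝ (Fin n))
    (y : EuclideanSpace ℝ (Fin m)) :
    inner ℝ (toEuclideanLin A x) y = inner ℝ x (toEuclideanLin Aᵀ y) := by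
  rw [← adjoint_toEuclideanLin, LinearMap.adjoint_inner_right]

lemma isSymmetric_toEuclideanLin {A : Matrix (Fin n) (Fin n) ℝ} (h : A.IsSymm) :
    (toEuclideanLin A).IsSymmetric := fun x y => by
  rw [inner_toEuclideanLin_left, h.eq]

lemma norm_toEuclideanLin_of_transpose_mul_self {U : Matrix (Fin m) (Fin n) ℝ} (h : Uᵀ * U = 1)
    (x : EuclideanSpace ℝ (Fin n)) : ‖toEuclideanLin U x‖ = ‖x‖ := by
  rw [← sq_eq_sq₀ (norm_nonneg _) (norm_nonneg _), ← real_inner_self_eq_norm_sq,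
    inner_toEuclideanLin_left, ← toEuclideanLin_mul_apply, h, Matrix.toLpLin_one,
    LinearMap.id_apply, real_inner_self_eq_norm_sq]

lemma norm_toEuclideanLin_transpose_le {U : Matrix (Fin m) (Fin n) ℝ} (h : Uᵀ * U = 1)
    (x : EuclideanSpace ℝ (Fin m)) : ‖toEuclideanLin Uᵀ x‖ ≤ ‖x‖ := by
  have h1 : ‖toEuclideanLin Uᵀ x‖ ^ 2 ≤ ‖toEuclideanLin Uᵀ x‖ * ‖x‖ := by
    rw [← real_inner_self_eq_norm_sq, inner_toEuclideanLin_left, Matrix.transpose_transpose]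
    refine (real_inner_le_norm _ _).trans ?_
    rw [norm_toEuclideanLin_of_transpose_mul_self h, mul_comm]
  rcases (norm_nonneg (toEuclideanLin Uᵀ x)).eq_or_lt with h0 | h0
  · rw [← h0]; positivity
  · rw [sq] at h1
    exact le_of_mul_le_mul_left h1 h0

lemma norm_sub_proj_le {U : Matrix (Fin m) (Fin n) ℝ} (h : Uᵀ * U = 1)
    (x : EuclideanSpace ℝ (Fin m)) : ‖toEuclideanLin (1 - U * Uᵀ) x‖ ≤ ‖x‖ := by
  refine abs_le_of_sq_le_sq' ?_ (norm_nonneg _) |>.2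
  have e1 : toEuclideanLin (1 - U * Uᵀ) x = x - toEuclideanLin U (toEuclideanLin Uᵀ x) := by
    rw [map_sub, LinearMap.sub_apply, toEuclideanLin_mul_apply, Matrix.toLpLin_one]; rfl
  rw [e1, @norm_sub_sq_real, norm_toEuclideanLin_of_transpose_mul_self h,
    real_inner_comm, inner_toEuclideanLin_left, real_inner_self_eq_norm_sq]
  nlinarith [sq_nonneg ‖toEuclideanLin Uᵀ x‖]

/-- The row counts may differ: this is needed to compare `Uᵀ * T`, which has `k` rows, with `M`. -/
lemma sv_le_sv_add {l : ℕ} (A : Matrix (Fin m) (Fin n) ℝ) (B : Matrix (Fin l) (Fin n) ℝ) {c : ℝ}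
    (hc : 0 ≤ c) (h : ∀ x, ‖toEuclideanLin A x‖ ≤ ‖toEuclideanLin B x‖ + c * ‖x‖) (i : ℕ) :
    sv A i ≤ sv B i + c :=
  singularValues_le_add _ _ hc h i

lemma sv_le_sv_add_norm_sub (A B : Matrix (Fin m) (Fin n) ℝ) (i : ℕ) :
    sv A i ≤ sv B i + ‖A - B‖ := by
  refine sv_le_sv_add A B (norm_nonneg _) (fun x => ?_) i
  have h1 := norm_le_insert' (toEuclideanLin A x) (toEuclideanLin B x)
  have h2 := norm_toEuclideanLin_le (A - B) x
  rw [map_sub, LinearMap.sub_apply] at h2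
  linarith

lemma continuous_sv (i : ℕ) : Continuous fun A : Matrix (Fin m) (Fin n) ℝ => sv A i := by
  refine LipschitzWith.continuous (K := 1) (LipschitzWith.of_dist_le_mul fun A B => ?_)
  rw [NNReal.coe_one, one_mul, Real.dist_eq, dist_eq_norm, abs_le]
  have h1 := sv_le_sv_add_norm_sub A B i
  have h2 := sv_le_sv_add_norm_sub B A i
  rw [norm_sub_rev] at h2
  constructor <;> linarith

lemma sv_nonneg (A : Matrix (Fin m) (Fin n) ℝ) (i : ℕ) : 0 ≤ sv A i :=
  LinearMap.singularValues_nonneg _ i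

lemma norm_le_sv_zero (A : Matrix (Fin m) (Fin n) ℝ) : ‖A‖ ≤ sv A 0 :=
  l2_opNorm_le_of_forall A (sv_nonneg A 0) fun x => norm_apply_le_singularValues_zero _ x

lemma finrank_range_toEuclideanLin (A : Matrix (Fin m) (Fin n) ℝ) :
    finrank ℝ (LinearMap.range (toEuclideanLin A)) = A.rank := by
  rw [Matrix.rank_eq_finrank_range_toLin A (EuclideanSpace.basisFun (Fin m) ℝ).toBasis
    (EuclideanSpace.basisFun (Fin n) ℝ).toBasis, Matrix.toEuclideanLin_eq_toLin_orthonormal]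

lemma sv_pos_of_lt_rank (A : Matrix (Fin m) (Fin n) ℝ) {i : ℕ} (h : i < A.rank) : 0 < sv A i := by
  rw [← finrank_range_toEuclideanLin] at h
  exact (LinearMap.singularValues_pos_iff_lt_finrank_range _).2 h

end MatrixLin

/-! ### Singular values of a symmetric matrix and its condition number. -/

section ConditionNumber

open Matrix (toEuclideanLin)

variable {n : ℕ} {M : Matrix (Fin n) (Fin n) ℝ}

/-- Let `v` be an eigenvector of `M ^ 2` for `s ^ 2` and factor `(M - s) (M + s) v = 0`. Either `M v
= -s v`, or `M v + s v` is an eigenvector for `s`. -/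
lemma exists_mem_spectrum_abs_eq_sv (hM : M.IsSymm) {i : ℕ} (hi : i < n) :
    ∃ z ∈ spectrum ℝ M, |z| = sv M i := by
  have h := LinearMap.hasEigenvalue_adjoint_comp_self_sq_singularValues (toEuclideanLin M)
    (n := i) (by simpa using hi)
  rw [adjoint_toEuclideanLin, hM.eq] at h
  obtain ⟨v, hv⟩ := h.exists_hasEigenvector
  have hv1 : toEuclideanLin M (toEuclideanLin M v) = (sv M i ^ 2) • v := hv.apply_eq_smul
  have hs := sv_nonneg M i
  by_cases hz : toEuclideanLin M v + sv M i • v = 0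
  · refine ⟨-sv M i, ?_, by rw [abs_neg, abs_of_nonneg hs]⟩
    rw [← Matrix.spectrum_toLpLin 2]
    refine (Module.End.hasEigenvalue_of_hasEigenvector (x := v)
      ⟨Module.End.mem_eigenspace_iff.2 ?_, hv.2⟩).mem_spectrum
    rw [neg_smul]
    exact eq_neg_of_add_eq_zero_left hz
  · refine ⟨sv M i, ?_, abs_of_nonneg hs⟩
    rw [← Matrix.spectrum_toLpLin 2]
    refine (Module.End.hasEigenvalue_of_hasEigenvector (x := toEuclideanLin M v + sv M i • v)
      ⟨Module.End.mem_eigenspace_iff.2 ?_, hz⟩).mem_spectrum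
    rw [map_add, map_smul, hv1, smul_add, smul_smul, sq, add_comm]

lemma norm_le_condNumber_mul (hM : M.IsSymm) {k : ℕ} (hk : 1 ≤ k) (hr : M.rank = k) :
    ‖M‖ ≤ condNumber M * sv M (k - 1) := by
  have hkn : k ≤ n := by
    have := M.rank_le_width
    omega
  have hk0 : 0 < sv M (k - 1) := sv_pos_of_lt_rank M (by omega)
  have h0 : 0 < sv M 0 := sv_pos_of_lt_rank M (by omega)
  have hfin : (abs '' (spectrum ℝ M \ {0})).Finite := (M.finite_real_spectrum.sdiff).image _
  have hmem : ∀ i, i < n → 0 < sv M i → sv M i ∈ abs '' (spectrum ℝ M \ {0}) := by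
    intro i hi hpos
    obtain ⟨z, hz, hzi⟩ := exists_mem_spectrum_abs_eq_sv hM hi
    refine ⟨z, ⟨hz, fun h => ?_⟩, hzi⟩
    rw [Set.mem_singleton_iff.1 h, abs_zero] at hzi
    linarith
  have hmem0 := hmem 0 (by omega) h0
  have hmemk := hmem (k - 1) (by omega) hk0
  have h1 : sv M 0 ≤ sSup (abs '' (spectrum ℝ M \ {0})) := le_csSup hfin.bddAbove hmem0
  have h2 : sInf (abs '' (spectrum ℝ M \ {0})) ≤ sv M (k - 1) := csInf_le hfin.bddBelow hmemk
  have h3 : 0 < sInf (abs '' (spectrum ℝ M \ {0})) := by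
    obtain ⟨z, hz, hz'⟩ := Set.Nonempty.csInf_mem ⟨_, hmem0⟩ hfin
    rw [← hz']
    exact abs_pos.2 hz.2
  calc ‖M‖ ≤ sv M 0 := norm_le_sv_zero M
    _ ≤ sSup (abs '' (spectrum ℝ M \ {0})) := h1
    _ = condNumber M * sInf (abs '' (spectrum ℝ M \ {0})) := by
      rw [condNumber, div_mul_cancel₀ _ h3.ne']
    _ ≤ _ := mul_le_mul_of_nonneg_left h2 (div_nonneg (h0.le.trans h1) h3.le)

lemma sv_le_norm {m : ℕ} (A : Matrix (Fin m) (Fin n) ℝ) (i : ℕ) : sv A i ≤ ‖A‖ :=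
  singularValues_le_of_submodule _ (norm_nonneg A) ⊤ (by simp) fun x _ => norm_toEuclideanLin_le A x

lemma one_le_condNumber (hM : M.IsSymm) {k : ℕ} (hk : 1 ≤ k) (hr : M.rank = k) :
    1 ≤ condNumber M := by
  have h1 := norm_le_condNumber_mul hM hk hr
  have h2 := sv_le_norm M (k - 1)
  have hk0 : 0 < sv M (k - 1) := sv_pos_of_lt_rank M (by omega)
  exact le_of_mul_le_mul_right (by linarith) hk0

end ConditionNumber

/-! ### Deterministic error analysis of one sketch. -/

section Sketching

open Matrix (toEuclideanLin)

variable {n m k : ℕ}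

/-- The given triples need not be completed to a full singular value decomposition. If the residual
`W` stretched some vector too much, that vector could be taken orthogonal to the columns of `V`;
adjoined to the leading columns of `V` it would make some singular value of `Y` larger than it is.
-/
lemma IsLeadingLeftSingular.norm_sub_proj_le {Y : Matrix (Fin n) (Fin m) ℝ}
    {U : Matrix (Fin n) (Fin k) ℝ} (h : IsLeadingLeftSingular Y U)
    (z : EuclideanSpace ℝ (Fin m)) :
    ‖toEuclideanLin ((1 - U * Uᵀ) * Y) z‖ ≤ sv Y k * ‖z‖ := by
  obtain ⟨hU, V, hV, hYV, hYU⟩ := h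
  set D : Matrix (Fin k) (Fin k) ℝ := Matrix.diagonal fun i : Fin k => sv Y i with hD
  set W := (1 - U * Uᵀ) * Y with hW
  have hUY : Uᵀ * Y = D * Vᵀ := by
    have := congrArg Matrix.transpose hYU
    rwa [Matrix.transpose_mul, Matrix.transpose_transpose, Matrix.transpose_mul,
      hD, Matrix.diagonal_transpose] at this
  have hWY : Y = U * (D * Vᵀ) + W := by
    rw [hW, Matrix.sub_mul, Matrix.one_mul, Matrix.mul_assoc, hUY]; abel
  have hWV : W * V = 0 := by
    rw [hW, Matrix.mul_assoc, hYV, Matrix.sub_mul, Matrix.one_mul, Matrix.mul_assoc,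
      ← Matrix.mul_assoc Uᵀ, hU, Matrix.one_mul, sub_self]
  have hUW : Uᵀ * W = 0 := by
    rw [hW, ← Matrix.mul_assoc, Matrix.mul_sub, Matrix.mul_one, ← Matrix.mul_assoc, hU,
      Matrix.one_mul, sub_self, Matrix.zero_mul]
  by_contra! hcon
  set x := toEuclideanLin (1 - V * Vᵀ) z with hx
  have hWx : toEuclideanLin W x = toEuclideanLin W z := by
    rw [hx, ← toEuclideanLin_mul_apply, Matrix.mul_sub, ← Matrix.mul_assoc, hWV, Matrix.zero_mul,
      sub_zero, Matrix.mul_one]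
  have hVx : toEuclideanLin Vᵀ x = 0 := by
    rw [hx, ← toEuclideanLin_mul_apply, Matrix.mul_sub, ← Matrix.mul_assoc, hV, Matrix.one_mul,
      Matrix.mul_one, sub_self, map_zero]; rfl
  have hxz : ‖x‖ ≤ ‖z‖ := RSVD.norm_sub_proj_le hV z
  have hsv0 := sv_nonneg Y k
  have hWpos : 0 < ‖toEuclideanLin W x‖ := by
    rw [hWx]; exact lt_of_le_of_lt (by positivity) hcon
  have hx0 : x ≠ 0 := fun h => by rw [h, map_zero, norm_zero] at hWpos; exact lt_irrefl _ hWpos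
  have hxn : 0 < ‖x‖ := norm_pos_iff.2 hx0
  set c := ‖toEuclideanLin W x‖ / ‖x‖ with hc
  have hc0 : 0 ≤ c := by positivity
  have hcx : c * ‖x‖ = ‖toEuclideanLin W x‖ := div_mul_cancel₀ _ hxn.ne'
  have hkc : sv Y k < c := by
    rw [hc, lt_div_iff₀ hxn, hWx]
    exact lt_of_le_of_lt (by gcongr) hcon
  have hex : ∃ j, sv Y j < c := ⟨k, hkc⟩
  classical
  -- The first index whose singular value is below `c`. The first `j` columns of `V` together with
  -- `x` span a space of dimension `j + 1` on which `Y` is bounded below by `c`, contradicting the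
  -- choice of `j`.
  set j := Nat.find hex with hj
  have hjc : sv Y j < c := Nat.find_spec hex
  have hjk : j ≤ k := Nat.find_min' hex hkc
  have hlt : ∀ i < j, c ≤ sv Y i := fun i hi => not_lt.1 (Nat.find_min hex hi)
  set J : Finset (Fin k) := {i | (i : ℕ) < j} with hJ
  have hJcard : J.card = j := by
    rw [hJ, Fin.card_filter_val_lt]; omega
  let C := coordSpan (EuclideanSpace.basisFun (Fin k) ℝ) J
  have hVinj : Function.Injective (toEuclideanLin V) := by
    rw [← LinearMap.ker_eq_bot, LinearMap.ker_eq_bot']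
    intro y hy
    rw [← norm_eq_zero, ← norm_toEuclideanLin_of_transpose_mul_self hV, hy, norm_zero]
  let S1 := C.map (toEuclideanLin V)
  have hS1 : finrank ℝ S1 = j := by
    rw [← (Submodule.equivMapOfInjective _ hVinj C).finrank_eq, finrank_coordSpan, hJcard]
  let S2 := Submodule.span ℝ {x}
  have hS2 : finrank ℝ S2 = 1 := finrank_span_singleton hx0
  have hinf : S1 ⊓ S2 = ⊥ := by
    rw [Submodule.eq_bot_iff]
    rintro y ⟨⟨w, hw, rfl⟩, hy2⟩
    obtain ⟨a, ha⟩ := Submodule.mem_span_singleton.1 hy2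
    have : toEuclideanLin Vᵀ (toEuclideanLin V w) = w := by
      rw [← toEuclideanLin_mul_apply, hV, Matrix.toLpLin_one]; rfl
    rw [← ha, map_smul, hVx, smul_zero] at this
    rw [← this, map_zero]
  have hsum := Submodule.finrank_sup_add_finrank_inf_eq S1 S2
  rw [hinf, finrank_bot, hS1, hS2] at hsum
  refine absurd (le_singularValues_of_submodule (toEuclideanLin Y) (i := j) (c := c) (S1 ⊔ S2)
    (by omega) ?_) (not_le.2 hjc)
  intro u hu
  obtain ⟨_, ⟨w, hw, rfl⟩, _, hy2, rfl⟩ := Submodule.mem_sup.1 hu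
  obtain ⟨a, rfl⟩ := Submodule.mem_span_singleton.1 hy2
  have hY1 : toEuclideanLin Y (toEuclideanLin V w + a • x) =
      toEuclideanLin U (toEuclideanLin D w) + a • toEuclideanLin W x := by
    rw [map_add, map_smul, ← toEuclideanLin_mul_apply, hYV, toEuclideanLin_mul_apply]
    congr 2
    conv_lhs => rw [hWY]
    rw [map_add, LinearMap.add_apply, toEuclideanLin_mul_apply, toEuclideanLin_mul_apply, hVx]
    simp
  have hDw : c * ‖w‖ ≤ ‖toEuclideanLin D w‖ := by
    refine abs_le_of_sq_le_sq' ?_ (norm_nonneg _) |>.2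
    rw [mul_pow, EuclideanSpace.real_norm_sq_eq, EuclideanSpace.real_norm_sq_eq, Finset.mul_sum]
    refine Finset.sum_le_sum fun i _ => ?_
    have hDi : (toEuclideanLin D w) i = sv Y i * w i := by
      simp [hD, Matrix.toLpLin_apply, Matrix.mulVec_diagonal]
    rw [hDi, mul_pow]
    by_cases hi : i ∈ J
    · have := hlt i (by simpa [hJ] using hi)
      gcongr
    · have : w i = 0 := by simpa using repr_eq_zero_of_mem_coordSpan hw hi
      simp [this]
  have o1 : inner ℝ (toEuclideanLin V w) (a • x) = 0 := by
    rw [inner_smul_right, inner_toEuclideanLin_left, hVx, inner_zero_right, mul_zero]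
  have o2 : inner ℝ (toEuclideanLin U (toEuclideanLin D w)) (a • toEuclideanLin W x) = 0 := by
    rw [inner_smul_right, inner_toEuclideanLin_left, ← toEuclideanLin_mul_apply Uᵀ, hUW]
    simp
  refine abs_le_of_sq_le_sq' ?_ (norm_nonneg _) |>.2
  have n1 := norm_add_sq_eq_norm_sq_add_norm_sq_of_inner_eq_zero _ _ o1
  have n2 := norm_add_sq_eq_norm_sq_add_norm_sq_of_inner_eq_zero _ _ o2
  rw [← sq, ← sq, ← sq] at n1 n2
  change (c * ‖toEuclideanLin V w + a • x‖) ^ 2 ≤ ‖toEuclideanLin Y (toEuclideanLin V w + a • x)‖ ^ 2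
  rw [hY1, mul_pow, n1, n2, norm_toEuclideanLin_of_transpose_mul_self hV,
    norm_toEuclideanLin_of_transpose_mul_self hU, norm_smul, norm_smul, mul_pow, mul_pow, ← hcx]
  have := pow_le_pow_left₀ (by positivity) hDw 2
  nlinarith

variable {M T : Matrix (Fin n) (Fin n) ℝ}

/-- The data of the spectral splitting of a perturbation of a matrix of rank `k`. -/
lemma exists_splitsAt_of_norm_sub_le (hT : T.IsSymm) (hk : 1 ≤ k) (hr : M.rank = k) {e : ℝ}
    (he : ‖T - M‖ ≤ e) (hek : 2 * e < sv M (k - 1)) :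
    ∃ K : Submodule ℝ (EuclideanSpace ℝ (Fin n)), finrank ℝ K = k ∧
      SplitsAt (toEuclideanLin T) K (sv M (k - 1) - e) e := by
  refine exists_splitsAt (isSymmetric_toEuclideanLin hT) (N := toEuclideanLin M) hk
    (by rw [finrank_range_toEuclideanLin, hr]) (fun x => ?_) hek ((norm_nonneg _).trans he)
  rw [← LinearMap.sub_apply, ← map_sub]
  exact (norm_toEuclideanLin_le _ x).trans (by gcongr)

lemma sv_pow_mul_eq (g : ℕ) (G : Matrix (Fin n) (Fin m) ℝ) (i : ℕ) :
    sv (T ^ g * G) i = ((toEuclideanLin T ^ g) ∘ₗ toEuclideanLin G).singularValues i := by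
  rw [sv, Matrix.toLpLin_mul_same, Matrix.toLpLin_pow]

/-- Error bound for the leading singular values returned by one accepted sketch. -/
theorem abs_sv_sub_sv_le (hT : T.IsSymm) (hk : 1 ≤ k) (hr : M.rank = k) {e : ℝ}
    (he : ‖T - M‖ ≤ e) (hek : 2 * e < sv M (k - 1)) {g : ℕ}
    {G : Matrix (Fin n) (Fin m) ℝ} {B t : ℝ} (hB : ‖G‖ ≤ B) (ht : 0 < t)
    (hsv : t ≤ sv (T ^ g * G) (k - 1)) {U : Matrix (Fin n) (Fin k) ℝ}
    (hU : IsLeadingLeftSingular (T ^ g * G) U) (i : ℕ) :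
    |sv (Uᵀ * T) i - sv M i| ≤ 2 * e + 4 * (e ^ g * B) / t * (‖M‖ + e) := by
  have he0 : 0 ≤ e := (norm_nonneg _).trans he
  have hB0 : 0 ≤ B := (norm_nonneg _).trans hB
  obtain ⟨K, hKk, hK⟩ := exists_splitsAt_of_norm_sub_le hT hk hr he hek
  have hKg := hK.pow (by linarith) he0 g
  have hUU := hU.1
  rw [sv_pow_mul_eq] at hsv
  set Q : Matrix (Fin n) (Fin n) ℝ := 1 - U * Uᵀ with hQ
  have core : ∀ w ∈ K, ‖toEuclideanLin Q w‖ ≤ 4 * (e ^ g * B) / t * ‖w‖ := fun w hw => by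
    refine hKg.norm_apply_le_of_mem (by positivity) (toEuclideanLin G) hB0 ht
      (fun z => (norm_toEuclideanLin_le G z).trans (by gcongr)) hk hKk hsv (toEuclideanLin Q)
      (RSVD.norm_sub_proj_le hUU) (fun z => ?_) hw
    rw [← sv_pow_mul_eq, ← LinearMap.comp_apply (toEuclideanLin T ^ g), ← Matrix.toLpLin_pow,
      ← Matrix.toLpLin_mul_same, ← toEuclideanLin_mul_apply]
    exact hU.norm_sub_proj_le z
  have hTM : ∀ x, ‖toEuclideanLin T x‖ ≤ ‖toEuclideanLin M x‖ + e * ‖x‖ := fun x => by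
    have h1 := norm_le_insert' (toEuclideanLin T x) (toEuclideanLin M x)
    have h2 : ‖toEuclideanLin T x - toEuclideanLin M x‖ ≤ e * ‖x‖ := by
      rw [← LinearMap.sub_apply, ← map_sub]
      exact (norm_toEuclideanLin_le _ x).trans (by gcongr)
    linarith
  have hMT : ∀ x, ‖toEuclideanLin M x‖ ≤ ‖toEuclideanLin T x‖ + e * ‖x‖ := fun x => by
    have h1 := norm_le_insert (toEuclideanLin T x) (toEuclideanLin M x)
    have h2 : ‖toEuclideanLin T x - toEuclideanLin M x‖ ≤ e * ‖x‖ := by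
      rw [← LinearMap.sub_apply, ← map_sub]
      exact (norm_toEuclideanLin_le _ x).trans (by gcongr)
    linarith
  set r := 4 * (e ^ g * B) / t * (‖M‖ + e) with hr'
  have hr0 : 0 ≤ r := by positivity
  rw [abs_sub_le_iff]
  constructor
  · have : sv (Uᵀ * T) i ≤ sv M i + e := sv_le_sv_add _ _ he0 (fun x => by
      rw [toEuclideanLin_mul_apply]
      exact (norm_toEuclideanLin_transpose_le hUU _).trans (hTM x)) i
    linarith
  · have : sv M i ≤ sv (Uᵀ * T) i + (2 * e + r) := by
      refine sv_le_sv_add _ _ (by positivity) (fun x => ?_) i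
      set y := toEuclideanLin T x with hy
      set p := K.starProjection x with hp
      have hp1 : ‖p‖ ≤ ‖x‖ := K.norm_starProjection_apply_le x
      have hq1 : ‖x - p‖ ≤ ‖x‖ := by
        rw [hp, ← Submodule.starProjection_orthogonal_val]
        exact Kᗮ.norm_starProjection_apply_le _
      -- What `U` misses of `T x` splits along `K` and `Kᗮ`: the first part is small because `U`
      -- nearly captures `K`, the second because `T` itself is at most `e` there.
      have hdec : y = toEuclideanLin U (toEuclideanLin Uᵀ y) +
          (toEuclideanLin Q (toEuclideanLin T p) + toEuclideanLin Q (toEuclideanLin T (x - p))) := by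
        rw [← map_add, ← map_add, add_sub_cancel, ← hy, hQ, map_sub, LinearMap.sub_apply,
          toEuclideanLin_mul_apply, Matrix.toLpLin_one]
        simp
      have hb1 : ‖toEuclideanLin Q (toEuclideanLin T p)‖ ≤ r * ‖x‖ := by
        refine (core _ (hK.map_mem _ (K.starProjection_apply_mem x))).trans ?_
        rw [hr', mul_assoc _ (‖M‖ + e)]
        refine mul_le_mul_of_nonneg_left ?_ (by positivity)
        have := (hTM p).trans (add_le_add_left (norm_toEuclideanLin_le M p) _)
        calc _ ≤ _ := this
          _ = (‖M‖ + e) * ‖p‖ := by ring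
          _ ≤ _ := by gcongr
      have hb2 : ‖toEuclideanLin Q (toEuclideanLin T (x - p))‖ ≤ e * ‖x‖ :=
        (RSVD.norm_sub_proj_le hUU _).trans
          ((hK.norm_le _ (K.sub_starProjection_mem_orthogonal x)).trans (by gcongr))
      have hb3 : ‖y‖ ≤ ‖toEuclideanLin (Uᵀ * T) x‖ + (r * ‖x‖ + e * ‖x‖) := by
        conv_lhs => rw [hdec]
        refine (norm_add_le _ _).trans (add_le_add ?_ ((norm_add_le _ _).trans (add_le_add hb1 hb2)))
        rw [norm_toEuclideanLin_of_transpose_mul_self hUU, toEuclideanLin_mul_apply]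
      have := hMT x
      linarith
    linarith

/-- A sketch that is well conditioned on the dominant eigenspace has a large `k`-th singular
value. -/
theorem exists_submodule_forall_le_sv (hT : T.IsSymm) (hk : 1 ≤ k) (hr : M.rank = k) {e : ℝ}
    (he : ‖T - M‖ ≤ e) (hek : 2 * e < sv M (k - 1)) (g : ℕ) :
    ∃ K : Submodule ℝ (EuclideanSpace ℝ (Fin n)), finrank ℝ K = k ∧
      ∀ (m : ℕ) (G : Matrix (Fin n) (Fin m) ℝ) (s : ℝ), 0 < s →
        (∀ x ∈ K, s * ‖x‖ ≤ ‖toEuclideanLin Gᵀ x‖) →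
        (sv M (k - 1) / 2) ^ g * s ≤ sv (T ^ g * G) (k - 1) := by
  have he0 : 0 ≤ e := (norm_nonneg _).trans he
  obtain ⟨K, hKk, hK⟩ := exists_splitsAt_of_norm_sub_le hT hk hr he hek
  refine ⟨K, hKk, fun m G s hs hG => ?_⟩
  rw [sv_pow_mul_eq]
  refine le_trans ?_ ((hK.pow (by linarith) he0 g).le_singularValues_comp
    (pow_nonneg (by linarith) g) (toEuclideanLin G) hs (fun x hx => ?_) (by omega))
  · gcongr <;> linarith
  · rw [adjoint_toEuclideanLin]
    exact hG x hx

end Sketching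

/-! ### Gaussian densities, dilations, chi-square tails and rotation invariance. -/

section GaussianVectors

variable {ι κ : Type*} [Fintype ι] [Fintype κ]

/-- The law of a family of independent standard normal variables. -/
noncomputable abbrev stdNormal (ι : Type*) [Fintype ι] : Measure (ι → ℝ) :=
  Measure.pi fun _ => gaussianReal 0 1

lemma pi_gaussianReal_eq_withDensity {v : NNReal} (hv : v ≠ 0) :
    Measure.pi (fun _ : ι => gaussianReal 0 v) =
      (volume : Measure (ι → ℝ)).withDensity
        fun x => ENNReal.ofReal (∏ i, gaussianPDFReal 0 v (x i)) := by
  refine Measure.pi_eq fun s hs => ?_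
  have hS : MeasurableSet (Set.univ.pi s) := MeasurableSet.univ_pi hs
  have hprod : ∀ x : ι → ℝ, (Set.univ.pi s).indicator
      (fun x => ∏ i, gaussianPDFReal 0 v (x i)) x =
      ∏ i, (s i).indicator (gaussianPDFReal 0 v) (x i) := by
    intro x
    by_cases hx : x ∈ Set.univ.pi s
    · rw [Set.indicator_of_mem hx]
      exact Finset.prod_congr rfl fun i _ => (Set.indicator_of_mem (hx i trivial) _).symm
    · rw [Set.indicator_of_notMem hx]
      obtain ⟨i, hi⟩ : ∃ i, x i ∉ s i := by simpa [Set.mem_univ_pi] using hx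
      exact (Finset.prod_eq_zero (Finset.mem_univ i) (Set.indicator_of_notMem hi _)).symm
  have hint : ∀ i, Integrable ((s i).indicator (gaussianPDFReal 0 v)) :=
    fun i => (integrable_gaussianPDFReal 0 v).indicator (hs i)
  have hnn : ∀ i y, 0 ≤ (s i).indicator (gaussianPDFReal 0 v) y :=
    fun i => Set.indicator_nonneg fun y _ => gaussianPDFReal_nonneg 0 v y
  rw [withDensity_apply _ hS, ← lintegral_indicator hS]
  have e1 : ∀ x : ι → ℝ, (Set.univ.pi s).indicator
      (fun x => ENNReal.ofReal (∏ i, gaussianPDFReal 0 v (x i))) x =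
      ENNReal.ofReal (∏ i, (s i).indicator (gaussianPDFReal 0 v) (x i)) := by
    intro x
    rw [← hprod]
    by_cases hx : x ∈ Set.univ.pi s
    · rw [Set.indicator_of_mem hx, Set.indicator_of_mem hx]
    · rw [Set.indicator_of_notMem hx, Set.indicator_of_notMem hx, ENNReal.ofReal_zero]
  simp_rw [e1]
  rw [volume_pi, ← ofReal_integral_eq_lintegral_ofReal (Integrable.fintype_prod hint)
      (Eventually.of_forall fun x => Finset.prod_nonneg fun i _ => hnn i _),
    integral_fintype_prod_eq_prod (𝕜 := ℝ) (fun i => (s i).indicator (gaussianPDFReal 0 v)),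
    ENNReal.ofReal_prod_of_nonneg fun i _ => integral_nonneg (hnn i)]
  refine Finset.prod_congr rfl fun i _ => ?_
  rw [gaussianReal_apply_eq_integral 0 hv, integral_indicator (hs i)]

lemma stdNormal_absolutelyContinuous : stdNormal ι ≪ (volume : Measure (ι → ℝ)) := by
  rw [stdNormal, pi_gaussianReal_eq_withDensity one_ne_zero]
  exact withDensity_absolutelyContinuous _ _

/-- Dilating a bounded set by a factor `c ≥ 1` costs a controlled amount of Gaussian mass. -/
lemma le_stdNormal_dilation {A : Set (ι → ℝ)} (hA : MeasurableSet A) {c r : ℝ} (hc : 1 ≤ c)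
    (hr : ∀ x ∈ A, ∑ i, x i ^ 2 ≤ r) :
    ENNReal.ofReal (Real.exp (-((c ^ 2 - 1) * r / 2))) * stdNormal ι A ≤
      stdNormal ι {y | c⁻¹ • y ∈ A} := by
  have hc0 : 0 < c := by linarith
  set v : NNReal := NNReal.mk (c ^ 2) (sq_nonneg c) with hv
  have hv0 : v ≠ 0 := by
    refine fun h => (pow_pos hc0 2).ne' ?_
    exact congrArg NNReal.toReal h
  have hA' : MeasurableSet {y : ι → ℝ | c⁻¹ • y ∈ A} :=
    (measurable_const_smul c⁻¹) hA
  have hmap : Measure.pi (fun _ : ι => gaussianReal 0 v) = (stdNormal ι).map (fun x => c • x) := by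
    have h1 : gaussianReal 0 v = (gaussianReal 0 1).map (fun x => c * x) := by
      rw [gaussianReal_map_const_mul, mul_zero, mul_one]
    have : ∀ _ : ι, SigmaFinite ((gaussianReal 0 1).map (fun x => c * x)) := fun _ => by
      rw [← h1]; infer_instance
    rw [h1, stdNormal, ← Measure.pi_map_pi (fun _ => by fun_prop)]
    rfl
  -- The mass of `A` is that of the dilated set under variance `c ^ 2`. It remains to compare the
  -- two densities on the dilated set; as `c ≥ 1`, the normalizing constants go in the favourable
  -- direction.
  have e1 : stdNormal ι A = Measure.pi (fun _ : ι => gaussianReal 0 v) {y | c⁻¹ • y ∈ A} := by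
    rw [hmap, Measure.map_apply (measurable_const_smul c) hA']
    congr 1
    ext x
    simp [smul_smul, inv_mul_cancel₀ hc0.ne']
  rw [e1, pi_gaussianReal_eq_withDensity hv0, stdNormal,
    pi_gaussianReal_eq_withDensity one_ne_zero, withDensity_apply _ hA', withDensity_apply _ hA',
    ← lintegral_const_mul']
  · refine setLIntegral_mono' hA' fun y hy => ?_
    rw [← ENNReal.ofReal_mul (Real.exp_pos _).le]
    refine ENNReal.ofReal_le_ofReal ?_
    have hy' := hr _ hy
    simp only [Pi.smul_apply, smul_eq_mul, mul_pow, ← Finset.mul_sum] at hy'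
    have hterm : ∀ i, Real.exp (-((1 - c⁻¹ ^ 2) * y i ^ 2 / 2)) * gaussianPDFReal 0 v (y i) ≤
        gaussianPDFReal 0 1 (y i) := by
      intro i
      rw [gaussianPDFReal, gaussianPDFReal]
      have hvc : (v : ℝ) = c ^ 2 := rfl
      rw [hvc, NNReal.coe_one, sub_zero, mul_one, mul_one, mul_left_comm, ← Real.exp_add]
      have e2 : -((1 - c⁻¹ ^ 2) * y i ^ 2 / 2) + -y i ^ 2 / (2 * c ^ 2) = -y i ^ 2 / 2 := by
        field_simp; ring
      rw [e2]
      refine mul_le_mul_of_nonneg_right ?_ (Real.exp_pos _).le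
      refine inv_anti₀ (by positivity) (Real.sqrt_le_sqrt ?_)
      have : 1 ≤ c ^ 2 := one_le_pow₀ hc
      have := Real.pi_pos
      nlinarith
    calc _ ≤ Real.exp (∑ i, -((1 - c⁻¹ ^ 2) * y i ^ 2 / 2)) *
          ∏ i, gaussianPDFReal 0 v (y i) := by
          refine mul_le_mul_of_nonneg_right (Real.exp_le_exp.2 ?_)
            (Finset.prod_nonneg fun i _ => gaussianPDFReal_nonneg _ _ _)
          rw [Finset.sum_neg_distrib, neg_le_neg_iff, ← Finset.sum_div, ← Finset.mul_sum]
          have h3 : (c ^ 2 - 1) * (c⁻¹ ^ 2 * ∑ i, y i ^ 2) = (1 - c⁻¹ ^ 2) * ∑ i, y i ^ 2 := by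
            field_simp
          have h4 : (c ^ 2 - 1) * (c⁻¹ ^ 2 * ∑ i, y i ^ 2) ≤ (c ^ 2 - 1) * r :=
            mul_le_mul_of_nonneg_left hy' (by nlinarith)
          linarith
      _ = ∏ i, (Real.exp (-((1 - c⁻¹ ^ 2) * y i ^ 2 / 2)) * gaussianPDFReal 0 v (y i)) := by
          rw [Real.exp_sum, Finset.prod_mul_distrib]
      _ ≤ _ := Finset.prod_le_prod
          (fun i _ => mul_nonneg (Real.exp_pos _).le (gaussianPDFReal_nonneg _ _ _))
          fun i _ => hterm i
  · exact ENNReal.ofReal_ne_top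

lemma exp_mul_sq_gaussianPDFReal (a x : ℝ) :
    gaussianPDFReal 0 1 x * Real.exp (a * x ^ 2) =
      (√(2 * Real.pi))⁻¹ * Real.exp (-(1 / 2 - a) * x ^ 2) := by
  rw [gaussianPDFReal, mul_assoc, ← Real.exp_add]
  simp only [NNReal.coe_one, sub_zero, mul_one]
  congr 2
  ring

lemma integrable_exp_mul_sq_gaussianReal {a : ℝ} (ha : a < 1 / 2) :
    Integrable (fun x => Real.exp (a * x ^ 2)) (gaussianReal 0 1) := by
  rw [gaussianReal_of_var_ne_zero 0 one_ne_zero, integrable_withDensity_iff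
    (measurable_gaussianPDF 0 1) (Eventually.of_forall fun x => ENNReal.ofReal_lt_top)]
  have : (fun x => Real.exp (a * x ^ 2) * (gaussianPDF 0 1 x).toReal) =
      fun x => (√(2 * Real.pi))⁻¹ * Real.exp (-(1 / 2 - a) * x ^ 2) := by
    ext x
    rw [toReal_gaussianPDF, mul_comm, exp_mul_sq_gaussianPDFReal]
  rw [this]
  exact (integrable_exp_neg_mul_sq (by linarith)).const_mul _

lemma integral_exp_mul_sq_gaussianReal {a : ℝ} (ha : a < 1 / 2) :
    ∫ x, Real.exp (a * x ^ 2) ∂gaussianReal 0 1 = (√(1 - 2 * a))⁻¹ := by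
  rw [integral_gaussianReal_eq_integral_smul one_ne_zero]
  simp_rw [smul_eq_mul, exp_mul_sq_gaussianPDFReal]
  rw [integral_const_mul, integral_gaussian, ← Real.sqrt_inv, ← Real.sqrt_inv,
    ← Real.sqrt_mul (by positivity)]
  congr 1
  have : 1 - 2 * a ≠ 0 := by linarith
  have h2 : 1 / 2 - a ≠ 0 := by linarith
  have := Real.pi_pos.ne'
  field_simp

lemma integrable_exp_mul_sum_sq {a : ℝ} (ha : a < 1 / 2) :
    Integrable (fun x : ι → ℝ => Real.exp (a * ∑ i, x i ^ 2)) (stdNormal ι) := by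
  simp_rw [Finset.mul_sum, Real.exp_sum]
  exact Integrable.fintype_prod fun _ => integrable_exp_mul_sq_gaussianReal ha

lemma integral_exp_mul_sum_sq {a : ℝ} (ha : a < 1 / 2) :
    ∫ x : ι → ℝ, Real.exp (a * ∑ i, x i ^ 2) ∂stdNormal ι =
      (√(1 - 2 * a))⁻¹ ^ Fintype.card ι := by
  simp_rw [Finset.mul_sum, Real.exp_sum]
  rw [integral_fintype_prod_eq_prod (𝕜 := ℝ) (fun _ x => Real.exp (a * x ^ 2))]
  simp [integral_exp_mul_sq_gaussianReal ha]

/-- Exponential Markov inequality. The parameter may be negative, so it yields the upper tail (`a =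
1 / 4`) as well as the small ball bound (`a = -1 / (2 * ε ^ 2)`). -/
lemma stdNormal_real_exp_le {a : ℝ} (ha : a < 1 / 2) (r : ℝ) :
    (stdNormal ι).real {x | r ≤ a * ∑ i, x i ^ 2} ≤
      Real.exp (-r) * (√(1 - 2 * a))⁻¹ ^ Fintype.card ι := by
  have h := mul_meas_ge_le_integral_of_nonneg (μ := stdNormal ι)
    (Eventually.of_forall fun x => (Real.exp_pos _).le)
    (integrable_exp_mul_sum_sq (ι := ι) ha) (Real.exp r)
  rw [integral_exp_mul_sum_sq ha] at h
  simp only [Real.exp_le_exp] at h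
  rw [Real.exp_neg, ← div_eq_inv_mul, le_div_iff₀ (Real.exp_pos r), mul_comm]
  exact h

/-- Upper tail of the chi-square distribution. -/
lemma stdNormal_real_le_sum_sq (r : ℝ) :
    (stdNormal ι).real {x | r ≤ ∑ i, x i ^ 2} ≤ Real.exp (Fintype.card ι / 2 - r / 4) := by
  have h := stdNormal_real_exp_le (ι := ι) (a := 1 / 4) (by norm_num) (r / 4)
  have e1 : {x : ι → ℝ | r / 4 ≤ 1 / 4 * ∑ i, x i ^ 2} = {x | r ≤ ∑ i, x i ^ 2} := by
    ext x
    simp only [Set.mem_ofPred_eq]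
    constructor <;> intro h <;> linarith
  rw [e1] at h
  refine h.trans ?_
  have e2 : (√(1 - 2 * (1 / 4 : ℝ)))⁻¹ ≤ Real.exp (1 / 2) := by
    rw [← Real.sqrt_inv, Real.sqrt_le_left (Real.exp_pos _).le, ← Real.exp_nat_mul]
    have := Real.add_one_le_exp (1 : ℝ)
    norm_num
    linarith
  calc _ ≤ Real.exp (-(r / 4)) * Real.exp (1 / 2) ^ Fintype.card ι := by gcongr
    _ = _ := by rw [← Real.exp_nat_mul, ← Real.exp_add]; congr 1; ring

/-- Small ball probability of the chi-square distribution. -/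
lemma stdNormal_real_sum_sq_le {ε : ℝ} (hε : 0 < ε) :
    (stdNormal ι).real {x | ∑ i, x i ^ 2 ≤ ε ^ 2 * Fintype.card ι} ≤
      (2 * ε) ^ Fintype.card ι := by
  have h := stdNormal_real_exp_le (ι := ι) (a := -(1 / (2 * ε ^ 2)))
    (by have : 0 < 1 / (2 * ε ^ 2) := by positivity
        linarith) (-(Fintype.card ι / 2))
  have e1 : {x : ι → ℝ | -((Fintype.card ι : ℝ) / 2) ≤ -(1 / (2 * ε ^ 2)) * ∑ i, x i ^ 2} =
      {x | ∑ i, x i ^ 2 ≤ ε ^ 2 * Fintype.card ι} := by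
    ext x
    simp only [Set.mem_ofPred_eq]
    rw [neg_mul, neg_le_neg_iff, one_div_mul_eq_div, div_le_iff₀ (by positivity)]
    constructor <;> intro h <;> linarith
  rw [e1] at h
  refine h.trans ?_
  rw [neg_neg, show (Fintype.card ι : ℝ) / 2 = Fintype.card ι * (1 / 2) by ring, Real.exp_nat_mul,
    ← mul_pow]
  refine pow_le_pow_left₀ (by positivity) ?_ _
  have e2 : (√(1 - 2 * -(1 / (2 * ε ^ 2))))⁻¹ ≤ ε := by
    rw [← Real.sqrt_inv, Real.sqrt_le_left hε.le]
    refine inv_le_of_inv_le₀ (by positivity) ?_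
    have : 1 - 2 * -(1 / (2 * ε ^ 2)) = 1 + (ε ^ 2)⁻¹ := by field_simp; ring
    linarith
  have e3 : Real.exp (1 / 2) ≤ 2 := by
    refine le_of_sq_le_sq ?_ zero_le_two
    rw [← Real.exp_nat_mul]
    have := Real.exp_one_lt_d9
    norm_num
    linarith
  gcongr

lemma stdNormal_eq_map_ofLp : stdNormal ι =
    (stdGaussian (EuclideanSpace ℝ ι)).map (WithLp.ofLp : EuclideanSpace ℝ ι → ι → ℝ) := by
  rw [← map_pi_eq_stdGaussian, Measure.map_map (by fun_prop) (by fun_prop)]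
  exact Measure.map_id.symm

/-- Rotation invariance of the standard normal law. -/
lemma stdNormal_map_mulVec [DecidableEq κ] (A : Matrix κ ι ℝ) (hA : A * Aᵀ = 1) :
    (stdNormal ι).map (fun x => A *ᵥ x) = stdNormal κ := by
  classical
  let L := (Matrix.toEuclideanLin A).toContinuousLinearMap
  have hL : (stdGaussian (EuclideanSpace ℝ ι)).map L = stdGaussian (EuclideanSpace ℝ κ) := by
    refine Measure.ext_of_charFun (funext fun t => ?_)
    rw [charFun_apply, integral_map L.continuous.aemeasurable (by fun_prop)]
    have e1 : ∀ x, inner ℝ (L x) t = inner ℝ x (ContinuousLinearMap.adjoint L t) := fun x =>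
      (ContinuousLinearMap.adjoint_inner_right L x t).symm
    simp_rw [e1]
    rw [← charFun_apply, charFun_stdGaussian, charFun_stdGaussian]
    have e2 : ‖ContinuousLinearMap.adjoint L t‖ = ‖t‖ := by
      rw [← sq_eq_sq₀ (norm_nonneg _) (norm_nonneg _), ← real_inner_self_eq_norm_sq,
        ContinuousLinearMap.adjoint_inner_right, ← real_inner_self_eq_norm_sq]
      congr 1
      have : ContinuousLinearMap.adjoint L t = Matrix.toEuclideanLin Aᵀ t := by
        rw [← Matrix.conjTranspose_eq_transpose_of_trivial,
          Matrix.toEuclideanLin_conjTranspose_eq_adjoint]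
        rfl
      rw [this]
      change Matrix.toEuclideanLin A (Matrix.toEuclideanLin Aᵀ t) = t
      rw [← LinearMap.comp_apply, ← Matrix.toLpLin_mul_same, hA, Matrix.toLpLin_one]
      rfl
    rw [e2]
  rw [stdNormal_eq_map_ofLp (ι := κ), stdNormal_eq_map_ofLp (ι := ι), ← hL, Measure.map_map (by fun_prop) (by fun_prop),
    Measure.map_map (by fun_prop) (by fun_prop)]
  rfl

end GaussianVectors

/-! ### Extreme singular values of rectangular Gaussian matrices. -/

section GaussianMatrices

open Matrix (toEuclideanLin)
open scoped Kronecker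

variable {m n k : ℕ}

/-- The matrix with a given family of entries. -/
def mat (H : Fin m × Fin n → ℝ) : Matrix (Fin m) (Fin n) ℝ := Matrix.of fun i j => H (i, j)

lemma continuous_mat : Continuous (mat : (Fin m × Fin n → ℝ) → Matrix (Fin m) (Fin n) ℝ) :=
  continuous_matrix fun i j => continuous_apply (i, j)

lemma continuous_norm_mat_transpose :
    Continuous fun p : (Fin m × Fin n → ℝ) × EuclideanSpace ℝ (Fin m) =>
      ‖toEuclideanLin (mat p.1)ᵀ p.2‖ := by
  refine continuous_norm.comp ?_
  simp only [Matrix.toLpLin_apply]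
  refine (PiLp.continuous_toLp 2 _).comp ?_
  exact Continuous.matrix_mulVec ((continuous_mat.comp continuous_fst).matrix_transpose)
    ((PiLp.continuous_ofLp 2 _).comp continuous_snd)

lemma continuous_norm_mat_transpose_left (x : EuclideanSpace ℝ (Fin m)) :
    Continuous fun H : Fin m × Fin n → ℝ => ‖toEuclideanLin (mat H)ᵀ x‖ := by
  have h : Continuous fun H : Fin m × Fin n → ℝ => (H, x) :=
    continuous_id.prodMk continuous_const
  have h' := (continuous_norm_mat_transpose (m := m) (n := n)).comp h
  exact h'

lemma continuous_norm_toEuclideanLin (A : Matrix (Fin m) (Fin n) ℝ) :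
    Continuous fun x => ‖toEuclideanLin A x‖ :=
  continuous_norm.comp (LinearMap.continuous_of_finiteDimensional _)

/-- On the array of entries, left multiplication by `Vᵀ` is the Kronecker product `Vᵀ ⊗ 1`, whose
rows are orthonormal; rotation invariance applies. -/
lemma stdNormal_map_transpose_mul {V : Matrix (Fin n) (Fin k) ℝ} (hV : Vᵀ * V = 1) :
    (stdNormal (Fin n × Fin m)).map (fun G p => (Vᵀ * mat G) p.1 p.2) =
      stdNormal (Fin k × Fin m) := by
  rw [← stdNormal_map_mulVec (Vᵀ ⊗ₖ (1 : Matrix (Fin m) (Fin m) ℝ))]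
  · congr 1
    ext G p
    simp [Matrix.mulVec, dotProduct, Fintype.sum_prod_type, Matrix.mul_apply, Matrix.one_apply, mat]
  · rw [← Matrix.kroneckerMap_transpose, ← Matrix.mul_kronecker_mul, Matrix.transpose_transpose, hV]
    simp

lemma measurable_transpose_mul_mat (V : Matrix (Fin n) (Fin k) ℝ) :
    Measurable fun (G : Fin n × Fin m → ℝ) (p : Fin k × Fin m) => (Vᵀ * mat G) p.1 p.2 := by
  refine measurable_pi_lambda _ fun p => ?_
  simp only [Matrix.mul_apply, mat, Matrix.of_apply]
  fun_prop

lemma stdNormal_norm_transpose_apply {x : EuclideanSpace ℝ (Fin n)} (hx : ‖x‖ = 1) {s : Set ℝ}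
    (hs : MeasurableSet s) :
    stdNormal (Fin n × Fin m) {H | ‖toEuclideanLin (mat H)ᵀ x‖ ^ 2 ∈ s} =
      stdNormal (Fin 1 × Fin m) {y | ∑ i, y i ^ 2 ∈ s} := by
  let V : Matrix (Fin n) (Fin 1) ℝ := Matrix.of fun i _ => x i
  have hV : Vᵀ * V = 1 := by
    ext i j
    have : ∑ l, x l * x l = 1 := by
      simp_rw [← sq]
      rw [← EuclideanSpace.real_norm_sq_eq, hx, one_pow]
    rw [Subsingleton.elim i j]
    simp [Matrix.mul_apply, V, this]
  rw [← stdNormal_map_transpose_mul hV, Measure.map_apply (measurable_transpose_mul_mat V)]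
  · congr 1
    ext H
    simp only [Set.mem_preimage, Set.mem_ofPred_eq]
    rw [EuclideanSpace.real_norm_sq_eq, Fintype.sum_prod_type, Fin.sum_univ_one]
    have : ∀ j, (toEuclideanLin (mat H)ᵀ x) j = (Vᵀ * mat H) 0 j := by
      intro j
      simp [Matrix.toLpLin_apply, Matrix.mulVec, dotProduct, Matrix.mul_apply, V, mul_comm]
    simp_rw [this]
  · exact (by fun_prop : Measurable fun y : Fin 1 × Fin m → ℝ => ∑ i, y i ^ 2) hs

lemma stdNormal_norm_transpose_le {x : EuclideanSpace ℝ (Fin n)} (hx : ‖x‖ = 1) {ε : ℝ}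
    (hε : 0 < ε) :
    stdNormal (Fin n × Fin m) {H | ‖toEuclideanLin (mat H)ᵀ x‖ ≤ ε * √m} ≤
      ENNReal.ofReal ((2 * ε) ^ m) := by
  have h := stdNormal_norm_transpose_apply (m := m) hx
    (measurableSet_Iic (a := ε ^ 2 * Fintype.card (Fin 1 × Fin m)))
  have h2 := stdNormal_real_sum_sq_le (ι := Fin 1 × Fin m) hε
  simp only [Set.mem_Iic, Fintype.card_prod, Fintype.card_fin, one_mul] at h h2
  calc _ = _ := by
        congr 1
        ext H
        have : ε ^ 2 * (m : ℝ) = (ε * √m) ^ 2 := by rw [mul_pow, Real.sq_sqrt (Nat.cast_nonneg m)]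
        rw [Set.mem_ofPred_eq, ← sq_le_sq₀ (norm_nonneg _) (by positivity), ← this]
        rfl
    _ = _ := h
    _ ≤ _ := (ENNReal.le_ofReal_iff_toReal_le (measure_ne_top _ _) (by positivity)).2 h2

lemma stdNormal_le_norm_transpose {x : EuclideanSpace ℝ (Fin n)} (hx : ‖x‖ = 1) {c : ℝ}
    (hc : 0 ≤ c) :
    stdNormal (Fin n × Fin m) {H | c * √m ≤ ‖toEuclideanLin (mat H)ᵀ x‖} ≤
      ENNReal.ofReal (Real.exp ((1 / 2 - c ^ 2 / 4) * m)) := by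
  have h := stdNormal_norm_transpose_apply (m := m) hx (measurableSet_Ici (a := c ^ 2 * m))
  have h2 := stdNormal_real_le_sum_sq (ι := Fin 1 × Fin m) (c ^ 2 * m)
  simp only [Set.mem_Ici, Fintype.card_prod, Fintype.card_fin, one_mul] at h h2
  calc _ = _ := by
        congr 1
        ext H
        have : c ^ 2 * (m : ℝ) = (c * √m) ^ 2 := by rw [mul_pow, Real.sq_sqrt (Nat.cast_nonneg m)]
        rw [Set.mem_ofPred_eq, ← sq_le_sq₀ (by positivity) (norm_nonneg _), ← this]
        rfl
    _ = _ := h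
    _ ≤ _ := by
        refine (ENNReal.le_ofReal_iff_toReal_le (measure_ne_top _ _) (Real.exp_pos _).le).2
          (h2.trans (le_of_eq ?_))
        congr 1
        ring

/-- A union bound over the unit ball, by averaging: if every bad outcome is witnessed by all
points of some ball of radius `r₁`, then its probability is at most the packing ratio times the
probability that a given point is a witness. -/
lemma measure_le_of_forall_ball {X : Type*} [MeasurableSpace X] (μ : Measure X) [SFinite μ]
    {D : Set (X × EuclideanSpace ℝ (Fin k))} (hD : MeasurableSet D) {B : Set X} {r₁ r₂ : ℝ}
    (h₁ : 0 < r₁) (h₂ : 0 < r₂) {p : ENNReal}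
    (hp : ∀ x ∈ Metric.ball (0 : EuclideanSpace ℝ (Fin k)) r₂, μ {ω | (ω, x) ∈ D} ≤ p)
    (hB : ∀ ω ∈ B, ∃ x₀, ∀ x ∈ Metric.ball x₀ r₁,
      x ∈ Metric.ball (0 : EuclideanSpace ℝ (Fin k)) r₂ ∧ (ω, x) ∈ D) :
    μ B ≤ ENNReal.ofReal ((r₂ / r₁) ^ k) * p := by
  set ν : Measure (EuclideanSpace ℝ (Fin k)) := volume.restrict (Metric.ball 0 r₂) with hν
  set v := (volume : Measure (EuclideanSpace ℝ (Fin k))) (Metric.ball 0 1) with hv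
  have hv0 : v ≠ 0 := (Metric.measure_ball_pos volume 0 one_pos).ne'
  have hvt : v ≠ ⊤ := measure_ball_lt_top.ne
  set f : X → ENNReal := fun ω => ν (Prod.mk ω ⁻¹' D) with hf
  have hfm : Measurable f := measurable_measure_prodMk_left hD
  have hball : ∀ (x : EuclideanSpace ℝ (Fin k)) {r : ℝ}, 0 < r →
      volume (Metric.ball x r) = ENNReal.ofReal (r ^ k) * v := fun x r hr => by
    rw [Measure.addHaar_ball_of_pos _ _ hr, finrank_euclideanSpace, Fintype.card_fin]
  -- A bad outcome has a whole small ball of witnesses. Markov's inequality for the witness volume,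
  -- followed by Fubini, replaces a covering net.
  have hBf : B ⊆ {ω | ENNReal.ofReal (r₁ ^ k) * v ≤ f ω} := by
    intro ω hω
    obtain ⟨x₀, hx₀⟩ := hB ω hω
    simp only [Set.mem_ofPred_eq]
    rw [hf, ← hball x₀ h₁]
    simp only
    rw [hν, Measure.restrict_apply (measurable_prodMk_left hD)]
    exact measure_mono fun x hx => ⟨(hx₀ x hx).2, (hx₀ x hx).1⟩
  have h1 : ENNReal.ofReal (r₁ ^ k) * v * μ B ≤ p * (ENNReal.ofReal (r₂ ^ k) * v) := by
    calc _ ≤ ENNReal.ofReal (r₁ ^ k) * v * μ {ω | ENNReal.ofReal (r₁ ^ k) * v ≤ f ω} := by gcongr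
      _ ≤ ∫⁻ ω, f ω ∂μ := mul_meas_ge_le_lintegral hfm _
      _ = (μ.prod ν) D := (Measure.prod_apply hD).symm
      _ = ∫⁻ x, μ ((fun ω => (ω, x)) ⁻¹' D) ∂ν := Measure.prod_apply_symm hD
      _ ≤ ∫⁻ _, p ∂ν := by
          refine lintegral_mono_ae ?_
          rw [hν, ae_restrict_iff' measurableSet_ball]
          exact Eventually.of_forall hp
      _ = p * (ENNReal.ofReal (r₂ ^ k) * v) := by
          rw [lintegral_const, hν, Measure.restrict_apply_univ, hball _ h₂]
  have hr₁ : ENNReal.ofReal (r₁ ^ k) ≠ 0 := by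
    rw [Ne, ENNReal.ofReal_eq_zero, not_le]; positivity
  have e1 : ENNReal.ofReal (r₂ ^ k) =
      ENNReal.ofReal (r₁ ^ k) * ENNReal.ofReal ((r₂ / r₁) ^ k) := by
    rw [← ENNReal.ofReal_mul (by positivity), ← mul_pow, mul_div_cancel₀ _ h₁.ne']
  rw [e1] at h1
  have h3 : (ENNReal.ofReal (r₁ ^ k) * v) * μ B ≤
      (ENNReal.ofReal (r₁ ^ k) * v) * (ENNReal.ofReal ((r₂ / r₁) ^ k) * p) := by
    refine h1.trans (le_of_eq ?_)
    ring
  exact (ENNReal.mul_le_mul_iff_right (mul_ne_zero hr₁ hv0)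
    (ENNReal.mul_ne_top ENNReal.ofReal_ne_top hvt)).1 h3

/-- The set of families of entries whose transposed matrix is bounded below by `c`. -/
def boundedBelow (m n : ℕ) (c : ℝ) : Set (Fin m × Fin n → ℝ) :=
  {H | ∀ x, c * ‖x‖ ≤ ‖toEuclideanLin (mat H)ᵀ x‖}

lemma isClosed_boundedBelow (c : ℝ) : IsClosed (boundedBelow m n c) := by
  have : boundedBelow m n c =
      ⋂ x, {H | c * ‖x‖ ≤ ‖toEuclideanLin (mat H)ᵀ x‖} := by
    ext H; simp [boundedBelow]
  rw [this]
  exact isClosed_iInter fun x => isClosed_le continuous_const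
    (continuous_norm_mat_transpose_left x)

lemma norm_toEuclideanLin_smul_inv (A : Matrix (Fin m) (Fin n) ℝ) {x : EuclideanSpace ℝ (Fin n)} :
    ‖toEuclideanLin A (‖x‖⁻¹ • x)‖ = ‖x‖⁻¹ * ‖toEuclideanLin A x‖ := by
  rw [map_smul, norm_smul, norm_inv, norm_norm]

lemma norm_inv_norm_smul {x : EuclideanSpace ℝ (Fin n)} (hx : x ≠ 0) : ‖‖x‖⁻¹ • x‖ = 1 := by
  rw [norm_smul, norm_inv, norm_norm, inv_mul_cancel₀ (norm_ne_zero_iff.2 hx)]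

/-- Upper tail of the operator norm of a Gaussian matrix. -/
lemma stdNormal_opNorm_le (hnm : k ≤ m) :
    stdNormal (Fin k × Fin m) {H | ∃ x, 21 * √m * ‖x‖ < ‖toEuclideanLin (mat H)ᵀ x‖} ≤
      ENNReal.ofReal (Real.exp (-(9 * m))) := by
  rcases Nat.eq_zero_or_pos m with rfl | hm
  · refine prob_le_one.trans ?_
    simp
  have hsm : 0 < √(m : ℝ) := Real.sqrt_pos.2 (by exact_mod_cast hm)
  let D : Set ((Fin k × Fin m → ℝ) × EuclideanSpace ℝ (Fin k)) :=
    {q | 21 / 2 * √m ≤ ‖toEuclideanLin (mat q.1)ᵀ q.2‖}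
  have hD : MeasurableSet D :=
    (isClosed_le continuous_const continuous_norm_mat_transpose).measurableSet
  -- Around a unit maximizer of the norm, radius `1 / 2` loses at most half of it, leaving `21 / 2 *
  -- √m` at vectors of length below `3 / 2`, that is `7 * √m` after normalization. The packing ratio
  -- `3 ^ k ≤ exp (2 * m)` is beaten because `2 + 1 / 2 - 49 / 4 < -9`.
  have key := measure_le_of_forall_ball (stdNormal (Fin k × Fin m)) hD
    (B := {H | ∃ x, 21 * √m * ‖x‖ < ‖toEuclideanLin (mat H)ᵀ x‖})
    (r₁ := 1 / 2) (r₂ := 3 / 2) (p := ENNReal.ofReal (Real.exp ((1 / 2 - 7 ^ 2 / 4) * m)))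
    (by norm_num) (by norm_num) ?_ ?_
  · refine key.trans ?_
    rw [← ENNReal.ofReal_mul (by positivity)]
    refine ENNReal.ofReal_le_ofReal ?_
    have h3 : (3 : ℝ) ≤ Real.exp 2 := by
      have := Real.add_one_le_exp (2 : ℝ)
      linarith
    calc ((3 / 2 / (1 / 2) : ℝ)) ^ k * Real.exp ((1 / 2 - 7 ^ 2 / 4) * m)
        ≤ Real.exp 2 ^ m * Real.exp ((1 / 2 - 7 ^ 2 / 4) * m) := by
          gcongr
          norm_num
          exact (pow_le_pow_right₀ (by norm_num) hnm).trans (pow_le_pow_left₀ (by norm_num) h3 _)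
      _ = Real.exp (m * 2 + (1 / 2 - 7 ^ 2 / 4) * m) := by
          rw [← Real.exp_nat_mul, Real.exp_add]
      _ ≤ _ := by
          refine Real.exp_le_exp.2 ?_
          have : (0 : ℝ) ≤ m := Nat.cast_nonneg m
          nlinarith
  · intro x hx
    rw [mem_ball_zero_iff] at hx
    rcases eq_or_ne x 0 with rfl | hx0
    · have : {ω : Fin k × Fin m → ℝ | (ω, (0 : EuclideanSpace ℝ (Fin k))) ∈ D} = ∅ := by
        ext ω
        simp only [D, Set.mem_ofPred_eq, map_zero, norm_zero, Set.mem_empty_iff_false, iff_false,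
          not_le]
        positivity
      rw [this, measure_empty]
      exact zero_le
    · refine le_trans (measure_mono fun ω hω => ?_)
        (stdNormal_le_norm_transpose (norm_inv_norm_smul hx0) (by norm_num : (0 : ℝ) ≤ 7))
      simp only [D, Set.mem_ofPred_eq] at hω ⊢
      have hxp := norm_pos_iff.2 hx0
      rw [norm_toEuclideanLin_smul_inv, inv_mul_eq_div, le_div_iff₀ hxp]
      nlinarith
  · rintro H ⟨y, hy⟩
    have hy0 : y ≠ 0 := by
      rintro rfl
      simp at hy
    have hne : (Metric.sphere (0 : EuclideanSpace ℝ (Fin k)) 1).Nonempty :=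
      ⟨‖y‖⁻¹ • y, by simpa using norm_inv_norm_smul hy0⟩
    obtain ⟨x₀, hx₀, hmax⟩ := (isCompact_sphere _ _).exists_isMaxOn hne
      (continuous_norm_toEuclideanLin (mat H)ᵀ).continuousOn
    set s := ‖toEuclideanLin (mat H)ᵀ x₀‖ with hs
    have hall : ∀ x, ‖toEuclideanLin (mat H)ᵀ x‖ ≤ s * ‖x‖ := by
      intro x
      rcases eq_or_ne x 0 with rfl | hx
      · simp
      · have := hmax (show ‖x‖⁻¹ • x ∈ Metric.sphere _ _ by simpa using norm_inv_norm_smul hx)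
        simp only [Set.mem_ofPred_eq] at this
        rwa [norm_toEuclideanLin_smul_inv, inv_mul_eq_div, div_le_iff₀ (norm_pos_iff.2 hx)] at this
    have hs1 : 21 * √m < s := by
      have := hy.trans_le (hall y)
      exact lt_of_mul_lt_mul_right this (norm_nonneg y)
    refine ⟨x₀, fun x hx => ⟨?_, ?_⟩⟩
    · rw [mem_ball_iff_norm] at hx
      rw [mem_ball_zero_iff]
      have h1 := norm_le_insert' x x₀
      have h2 : ‖x₀‖ = 1 := by simpa using hx₀
      linarith
    · rw [mem_ball_iff_norm'] at hx
      simp only [D, Set.mem_ofPred_eq]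
      have h1 := norm_le_insert' (toEuclideanLin (mat H)ᵀ x₀) (toEuclideanLin (mat H)ᵀ x)
      rw [← map_sub] at h1
      have h2 := hall (x₀ - x)
      have : s * ‖x₀ - x‖ ≤ s * (1 / 2) := by gcongr
      linarith

/-- The least singular value of a rectangular Gaussian matrix is of the order of the square root
of its larger side, up to an exponentially small probability. -/
lemma exists_stdNormal_compl_boundedBelow_le {c : ℝ} (hc : 1 < c) :
    ∃ δ : ℝ, 0 < δ ∧ ∀ k m : ℕ, 1 ≤ m → c * k ≤ m →
      stdNormal (Fin k × Fin m) (boundedBelow k m (δ * √m))ᶜ ≤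
        ENNReal.ofReal (Real.exp (-(7 * m))) := by
  have hc0 : 0 < c := by linarith
  have hci : c⁻¹ < 1 := inv_lt_one_of_one_lt₀ hc
  -- The packing ratio costs `(2 / δ) ^ k ≤ (2 / δ) ^ (m / c)` and the small ball gains `(88 * δ) ^
  -- m`. As `1 / c < 1`, the gain wins for small `δ`, at any prescribed exponential rate.
  obtain ⟨δ, ⟨hδ0, hδ1⟩, hδ⟩ : ∃ δ : ℝ, (0 < δ ∧ δ < 1 / 2) ∧
      (2 / δ) ^ c⁻¹ * (88 * δ) < Real.exp (-8) := by
    have h1 : Tendsto (fun δ : ℝ => 2 ^ c⁻¹ * 88 * δ ^ (1 - c⁻¹)) (𝓝[>] 0) (𝓝 0) := by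
      have : Tendsto (fun δ : ℝ => 2 ^ c⁻¹ * 88 * δ ^ (1 - c⁻¹)) (𝓝 0)
          (𝓝 (2 ^ c⁻¹ * 88 * 0 ^ (1 - c⁻¹))) :=
        (Real.continuousAt_rpow_const 0 (1 - c⁻¹) (Or.inr (by linarith))).tendsto.const_mul _
      rw [Real.zero_rpow (by linarith), mul_zero] at this
      exact this.mono_left nhdsWithin_le_nhds
    have h2 := h1.eventually_lt_const (Real.exp_pos (-8))
    have h3 : ∀ᶠ δ : ℝ in 𝓝[>] 0, 0 < δ ∧ δ < 1 / 2 := Ioo_mem_nhdsGT (by norm_num)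
    obtain ⟨δ, h, h'⟩ := (h2.and h3).exists
    refine ⟨δ, h', lt_of_eq_of_lt ?_ h⟩
    rw [Real.div_rpow zero_le_two h'.1.le, Real.rpow_sub h'.1, Real.rpow_one]
    ring
  refine ⟨δ, hδ0, fun k m hm hkm => ?_⟩
  have hsm : 0 < √(m : ℝ) := Real.sqrt_pos.2 (by exact_mod_cast hm)
  have hkm' : k ≤ m := by
    have : (k : ℝ) ≤ m := by nlinarith [(Nat.cast_nonneg k : (0 : ℝ) ≤ k)]
    exact_mod_cast this
  let D : Set ((Fin k × Fin m → ℝ) × EuclideanSpace ℝ (Fin k)) :=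
    {q | ‖toEuclideanLin (mat q.1)ᵀ q.2‖ ≤ 22 * δ * √m ∧ 1 / 2 ≤ ‖q.2‖}
  have hD : MeasurableSet D :=
    ((isClosed_le continuous_norm_mat_transpose continuous_const).inter
      (isClosed_le continuous_const (continuous_norm.comp continuous_snd))).measurableSet
  set B₁ : Set (Fin k × Fin m → ℝ) := {H | ∃ x, 21 * √m * ‖x‖ < ‖toEuclideanLin (mat H)ᵀ x‖} with hB₁
  set B₂ : Set (Fin k × Fin m → ℝ) := (boundedBelow k m (δ * √m))ᶜ \ B₁ with hB₂
  have h₁ : stdNormal _ B₁ ≤ ENNReal.ofReal (Real.exp (-(9 * m))) := stdNormal_opNorm_le hkm'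
  have h₂ : stdNormal _ B₂ ≤ ENNReal.ofReal (Real.exp (-(8 * m))) := by
    -- Off `B₁` the operator norm is at most `21 * √m`, so moving by `δ` from a unit witness raises
    -- its image norm to at most `22 * δ * √m`; lengths stay at least `1 / 2`, whence `44 * δ` after
    -- normalization.
    have key := measure_le_of_forall_ball (stdNormal (Fin k × Fin m)) hD (B := B₂)
      (r₁ := δ) (r₂ := 2) (p := ENNReal.ofReal ((2 * (44 * δ)) ^ m)) hδ0 two_pos ?_ ?_
    · refine key.trans ?_
      rw [← ENNReal.ofReal_mul (by positivity)]
      refine ENNReal.ofReal_le_ofReal ?_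
      have hbase : 1 ≤ 2 / δ := by rw [one_le_div hδ0]; linarith
      have e1 : (2 / δ) ^ k ≤ ((2 / δ) ^ c⁻¹) ^ m := by
        rw [← Real.rpow_natCast, ← Real.rpow_natCast, ← Real.rpow_mul (by positivity)]
        refine Real.rpow_le_rpow_of_exponent_le hbase ?_
        rw [inv_mul_eq_div, le_div_iff₀ hc0]
        linarith
      calc _ ≤ ((2 / δ) ^ c⁻¹) ^ m * (2 * (44 * δ)) ^ m := by gcongr
        _ = ((2 / δ) ^ c⁻¹ * (88 * δ)) ^ m := by rw [← mul_pow]; ring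
        _ ≤ Real.exp (-8) ^ m := by gcongr
        _ = _ := by rw [← Real.exp_nat_mul]; congr 1; ring
    · intro x _
      by_cases hx : 1 / 2 ≤ ‖x‖
      · have hxp : 0 < ‖x‖ := by linarith
        refine le_trans (measure_mono fun ω hω => ?_)
          (stdNormal_norm_transpose_le (norm_inv_norm_smul (norm_pos_iff.1 hxp))
            (by positivity : 0 < 44 * δ))
        simp only [D, Set.mem_ofPred_eq] at hω ⊢
        rw [norm_toEuclideanLin_smul_inv, inv_mul_eq_div, div_le_iff₀ hxp]
        have : 0 < δ * √m := by positivity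
        nlinarith [hω.1]
      · have : {ω : Fin k × Fin m → ℝ | (ω, x) ∈ D} = ∅ := by
          ext ω
          simp [D]
          intro _
          have := lt_of_not_ge hx
          norm_num at this
          linarith
        rw [this, measure_empty]
        exact zero_le
    · rintro H ⟨hH, hH1⟩
      have hall : ∀ x, ‖toEuclideanLin (mat H)ᵀ x‖ ≤ 21 * √m * ‖x‖ := by
        simpa [hB₁] using hH1
      obtain ⟨y, hy⟩ : ∃ y, ‖toEuclideanLin (mat H)ᵀ y‖ < δ * √m * ‖y‖ := by
        simpa [boundedBelow] using hH
      have hy0 : y ≠ 0 := by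
        rintro rfl
        simp at hy
      set x₀ := ‖y‖⁻¹ • y with hx₀
      have hx₀n : ‖x₀‖ = 1 := norm_inv_norm_smul hy0
      have hx₀s : ‖toEuclideanLin (mat H)ᵀ x₀‖ ≤ δ * √m := by
        rw [hx₀, norm_toEuclideanLin_smul_inv, inv_mul_eq_div, div_le_iff₀ (norm_pos_iff.2 hy0)]
        exact hy.le
      refine ⟨x₀, fun x hx => ?_⟩
      rw [mem_ball_iff_norm] at hx
      have h1 := norm_le_insert' x x₀
      have h2 := norm_le_insert x x₀
      refine ⟨by rw [mem_ball_zero_iff]; linarith, ?_, by simp only; linarith⟩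
      have h3 := norm_le_insert' (toEuclideanLin (mat H)ᵀ x) (toEuclideanLin (mat H)ᵀ x₀)
      rw [← map_sub] at h3
      have h4 := hall (x - x₀)
      have h5 : 21 * √m * ‖x - x₀‖ ≤ 21 * √m * δ := by gcongr
      simp only
      linarith
  calc _ ≤ stdNormal _ (B₁ ∪ B₂) := measure_mono fun H hH => by
        by_cases h : H ∈ B₁
        · exact Or.inl h
        · exact Or.inr ⟨hH, h⟩
    _ ≤ _ := measure_union_le _ _
    _ ≤ ENNReal.ofReal (Real.exp (-(9 * m))) + ENNReal.ofReal (Real.exp (-(8 * m))) :=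
        add_le_add h₁ h₂
    _ ≤ _ := by
        rw [← ENNReal.ofReal_add (Real.exp_pos _).le (Real.exp_pos _).le]
        refine ENNReal.ofReal_le_ofReal ?_
        have hm' : (1 : ℝ) ≤ m := by exact_mod_cast hm
        have a1 : Real.exp (-(9 * m)) ≤ Real.exp (-(8 * m)) := Real.exp_le_exp.2 (by linarith)
        have a2 : Real.exp (-(8 * m : ℝ)) = Real.exp (-(7 * m)) * Real.exp (-m) := by
          rw [← Real.exp_add]; congr 1; ring
        have a3 : Real.exp (-(m : ℝ)) ≤ 1 / 2 := by
          rw [Real.exp_neg, one_div]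
          refine inv_anti₀ two_pos ?_
          have := Real.add_one_le_exp (m : ℝ)
          linarith
        have := Real.exp_pos (-(7 * m : ℝ))
        nlinarith

end GaussianMatrices

/-! ### Almost sure injectivity, and small balls in fixed dimensions including square matrices. -/

section FixedDimensions

open Matrix (toEuclideanLin)

variable {m n k : ℕ}

lemma finite_setOf_det_add_smul_one_eq_zero (A : Matrix (Fin k) (Fin k) ℝ) :
    {t : ℝ | (A + t • (1 : Matrix (Fin k) (Fin k) ℝ)).det = 0}.Finite := by
  refine ((-A).charpoly.roots.toFinset.finite_toSet).subset fun t ht => ?_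
  simp only [Finset.mem_coe, Multiset.mem_toFinset]
  rw [Polynomial.mem_roots (-A).charpoly_monic.ne_zero, Polynomial.IsRoot.def, Matrix.eval_charpoly]
  rw [← (show (A + t • (1 : Matrix (Fin k) (Fin k) ℝ)).det = 0 from ht)]
  congr 1
  rw [sub_neg_eq_add, add_comm, Matrix.scalar_apply, Matrix.smul_one_eq_diagonal]

/-- The inclusion of the first `k` columns. -/
def firstColumns (h : k ≤ m) : Matrix (Fin m) (Fin k) ℝ :=
  Matrix.of fun j i => if j = Fin.castLE h i then 1 else 0

/-- Selecting the first `k` columns sends `D` to the identity, so along each line of direction `D`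
the determinant is a characteristic polynomial, with finitely many zeros. Fubini over `t` in `[0,
1]` and translation invariance then make the zero set null. -/
lemma volume_det_mul_firstColumns_eq_zero (h : k ≤ m) :
    volume {H : Fin k × Fin m → ℝ | (mat H * firstColumns h).det = 0} = 0 := by
  set Z := {H : Fin k × Fin m → ℝ | (mat H * firstColumns h).det = 0} with hZ
  let D : Fin k × Fin m → ℝ := fun p => if p.2 = Fin.castLE h p.1 then 1 else 0
  have hD : ∀ (H : Fin k × Fin m → ℝ) (t : ℝ), mat (H + t • D) * firstColumns h =
      mat H * firstColumns h + t • (1 : Matrix (Fin k) (Fin k) ℝ) := by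
    intro H t
    have h1 : mat (H + t • D) = mat H + t • mat D := rfl
    rw [h1, Matrix.add_mul, Matrix.smul_mul]
    congr 2
    ext i j
    simp [Matrix.mul_apply, mat, D, firstColumns, Matrix.one_apply, eq_comm]
  have hcont : Continuous fun H : Fin k × Fin m → ℝ => (mat H * firstColumns h).det :=
    (Continuous.matrix_mul continuous_mat continuous_const).matrix_det
  have hZm : MeasurableSet Z := (isClosed_eq hcont continuous_const).measurableSet
  let W : Set ((Fin k × Fin m → ℝ) × ℝ) := {q | q.1 + q.2 • D ∈ Z}
  have hW : MeasurableSet W := by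
    have : Continuous fun q : (Fin k × Fin m → ℝ) × ℝ => q.1 + q.2 • D := by fun_prop
    exact this.measurable hZm
  set ν : Measure ℝ := volume.restrict (Set.Icc 0 1)
  have h1 : ((volume : Measure (Fin k × Fin m → ℝ)).prod ν) W = 0 := by
    rw [Measure.prod_apply hW]
    refine lintegral_eq_zero_of_ae_eq_zero (Eventually.of_forall fun H => ?_)
    have hfin : (Prod.mk H ⁻¹' W).Finite := by
      refine (finite_setOf_det_add_smul_one_eq_zero (mat H * firstColumns h)).subset fun t ht => ?_
      have : (mat (H + t • D) * firstColumns h).det = 0 := ht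
      rwa [hD] at this
    exact hfin.measure_zero ν
  rw [Measure.prod_apply_symm hW] at h1
  have h2 : ∀ t : ℝ, volume ((fun H => (H, t)) ⁻¹' W) = volume Z := fun t =>
    measure_preimage_add_right volume (t • D) Z
  simp_rw [h2] at h1
  simpa [ν] using h1

lemma ae_injective_mat_transpose (h : k ≤ m) :
    ∀ᵐ H ∂stdNormal (Fin k × Fin m), ∃ c : ℝ, 0 < c ∧ H ∈ boundedBelow k m c := by
  have h1 : ∀ᵐ H ∂stdNormal (Fin k × Fin m), (mat H * firstColumns h).det ≠ 0 :=
    stdNormal_absolutelyContinuous.ae_le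
      (measure_eq_zero_iff_ae_notMem.1 (volume_det_mul_firstColumns_eq_zero h))
  filter_upwards [h1] with H hH
  have hker : LinearMap.ker (toEuclideanLin (mat H)ᵀ) = ⊥ := by
    rw [LinearMap.ker_eq_bot']
    intro x hx
    have h2 : toEuclideanLin (mat H * firstColumns h)ᵀ x = 0 := by
      rw [Matrix.transpose_mul, toEuclideanLin_mul_apply, hx, map_zero]
    have h3 : (mat H * firstColumns h)ᵀ *ᵥ x.ofLp = 0 := by
      have := congrArg WithLp.ofLp h2
      simpa [Matrix.toLpLin_apply] using this
    have := Matrix.eq_zero_of_mulVec_eq_zero (by rwa [Matrix.det_transpose]) h3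
    ext i
    simp [this]
  obtain ⟨K, hK, hK'⟩ := LinearMap.exists_antilipschitzWith _ hker
  refine ⟨(K : ℝ)⁻¹, by positivity, fun x => ?_⟩
  have := hK'.le_mul_dist x 0
  rw [map_zero, dist_zero_right, dist_zero_right] at this
  rwa [inv_mul_le_iff₀ (by exact_mod_cast hK)]

lemma boundedBelow_anti {c c' : ℝ} (h : c ≤ c') : boundedBelow k m c' ⊆ boundedBelow k m c :=
  fun _ hH x => (mul_le_mul_of_nonneg_right h (norm_nonneg x)).trans (hH x)

/-- When `k = m` there is no aspect ratio for the packing argument. For fixed dimensions almost sure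
injectivity and continuity of the measure along decreasing sets are enough, with `δ` depending on
`k` and `m`. -/
lemma exists_stdNormal_compl_boundedBelow_le_of_le (h : k ≤ m) (hm : 1 ≤ m) :
    ∃ δ : ℝ, 0 < δ ∧ stdNormal (Fin k × Fin m) (boundedBelow k m (δ * √m))ᶜ ≤
        ENNReal.ofReal (Real.exp (-(7 * m))) := by
  have hsm : 0 < √(m : ℝ) := Real.sqrt_pos.2 (by exact_mod_cast hm)
  let s : ℕ → Set (Fin k × Fin m → ℝ) := fun i => (boundedBelow k m (1 / ((i : ℝ) + 1) * √m))ᶜ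
  have hanti : Antitone s := fun i j hij => by
    refine Set.compl_subset_compl.2 (boundedBelow_anti ?_)
    gcongr
  have hzero : stdNormal (Fin k × Fin m) (⋂ i, s i) = 0 := by
    refine measure_mono_null (fun H hH => ?_) (ae_iff.1 (ae_injective_mat_transpose (k := k) h))
    rintro ⟨c, hc, hHc⟩
    obtain ⟨i, hi⟩ := exists_nat_one_div_lt (div_pos hc hsm)
    refine Set.mem_iInter.1 hH i (boundedBelow_anti ?_ hHc)
    rw [lt_div_iff₀ hsm] at hi
    exact hi.le
  have htend : Tendsto (fun i => stdNormal (Fin k × Fin m) (s i)) atTop (𝓝 0) := by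
    rw [← hzero]
    exact tendsto_measure_iInter_atTop
      (fun i => (isClosed_boundedBelow _).measurableSet.compl.nullMeasurableSet) hanti
      ⟨0, measure_ne_top _ _⟩
  have hev := htend.eventually_le_const
    (ENNReal.ofReal_pos.2 (Real.exp_pos (-(7 * m : ℝ))))
  obtain ⟨i, hi⟩ := hev.exists
  exact ⟨1 / ((i : ℝ) + 1), by positivity, hi⟩

end FixedDimensions

/-! ### Sketches restricted to a subspace, dilated sketches and independent copies. -/

section ManySketches

open Matrix (toEuclideanLin)

variable {m n k : ℕ}

/-- The families of entries whose transposed matrix is bounded below by `c` on `K`. -/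
def boundedBelowOn (m : ℕ) (K : Submodule ℝ (EuclideanSpace ℝ (Fin n))) (c : ℝ) :
    Set (Fin n × Fin m → ℝ) :=
  {G | ∀ x ∈ K, c * ‖x‖ ≤ ‖toEuclideanLin (mat G)ᵀ x‖}

lemma measurableSet_boundedBelowOn (K : Submodule ℝ (EuclideanSpace ℝ (Fin n))) (c : ℝ) :
    MeasurableSet (boundedBelowOn m K c) := by
  have : boundedBelowOn m K c =
      ⋂ x ∈ K, {H | c * ‖x‖ ≤ ‖toEuclideanLin (mat H)ᵀ x‖} := by
    ext H; simp [boundedBelowOn]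
  rw [this]
  exact (isClosed_biInter fun x _ => isClosed_le continuous_const
    (continuous_norm_mat_transpose_left x)).measurableSet

/-- In orthonormal coordinates on `K`, an `n × m` Gaussian sketch becomes a `k × m` Gaussian matrix,
so the ambient dimension disappears. -/
lemma stdNormal_boundedBelowOn_compl {K : Submodule ℝ (EuclideanSpace ℝ (Fin n))}
    (hK : finrank ℝ K = k) (c : ℝ) :
    stdNormal (Fin n × Fin m) (boundedBelowOn m K c)ᶜ ≤
      stdNormal (Fin k × Fin m) (boundedBelow k m c)ᶜ := by
  let b := (stdOrthonormalBasis ℝ K).reindex (finCongr hK)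
  let V : Matrix (Fin n) (Fin k) ℝ := Matrix.of fun i j => (b j : EuclideanSpace ℝ (Fin n)) i
  have hVx : ∀ y : EuclideanSpace ℝ (Fin k),
      toEuclideanLin V y = ((b.repr.symm y : K) : EuclideanSpace ℝ (Fin n)) := by
    intro y
    rw [← b.sum_repr (b.repr.symm y)]
    ext i
    simp [Matrix.toLpLin_apply, Matrix.mulVec, dotProduct, V, mul_comm]
  have hV : Vᵀ * V = 1 := by
    ext i j
    have := orthonormal_iff_ite.1 b.orthonormal i j
    rw [Submodule.coe_inner, PiLp.inner_apply] at this
    simp only [RCLike.inner_apply, conj_trivial] at this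
    simp only [Matrix.mul_apply, Matrix.transpose_apply, V, Matrix.of_apply, Matrix.one_apply]
    rw [← this]
    exact Finset.sum_congr rfl fun _ _ => mul_comm _ _
  rw [← stdNormal_map_transpose_mul hV, Measure.map_apply (measurable_transpose_mul_mat V)
    (isClosed_boundedBelow c).measurableSet.compl]
  refine measure_mono (Set.compl_subset_compl.2 ?_)
  intro G hG x hx
  have h1 := hG (b.repr ⟨x, hx⟩)
  rw [b.repr.norm_map] at h1
  refine h1.trans (le_of_eq ?_)
  have h2 : mat (fun p : Fin k × Fin m => (Vᵀ * mat G) p.1 p.2) = Vᵀ * mat G := rfl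
  rw [h2, Matrix.transpose_mul, Matrix.transpose_transpose, toEuclideanLin_mul_apply, hVx,
    LinearIsometryEquiv.symm_apply_apply]

lemma stdNormal_le_sum_sq (ι : Type*) [Fintype ι] (r : ℝ) :
    stdNormal ι {x | r ≤ ∑ i, x i ^ 2} ≤
      ENNReal.ofReal (Real.exp (Fintype.card ι / 2 - r / 4)) :=
  (ENNReal.le_ofReal_iff_toReal_le (measure_ne_top _ _) (Real.exp_pos _).le).2
    (stdNormal_real_le_sum_sq r)

/-- The well-conditioned sketches of squared Frobenius norm at most `8 * n * m` have probability at
least `1 / 2`. The truncation bounds the cost of dilating them by `t`, and dilation multiplies the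
lower bound by `t`. -/
lemma stdNormal_boundedBelowOn_scaled {K : Submodule ℝ (EuclideanSpace ℝ (Fin n))} (hn : 1 ≤ n)
    (hm : 1 ≤ m) {c : ℝ}
    (h : stdNormal (Fin n × Fin m) (boundedBelowOn m K c)ᶜ ≤ ENNReal.ofReal (Real.exp (-(7 * m))))
    {t : ℝ} (ht : 1 ≤ t) :
    ENNReal.ofReal (1 / 2 * Real.exp (-(4 * (n * m) * t ^ 2))) ≤
      stdNormal (Fin n × Fin m) (boundedBelowOn m K (t * c)) := by
  have ht0 : 0 < t := by linarith
  have hN : (1 : ℝ) ≤ n * m := by exact_mod_cast Nat.one_le_iff_ne_zero.2 (by positivity)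
  set A : Set (Fin n × Fin m → ℝ) := boundedBelowOn m K c ∩ {x | ∑ i, x i ^ 2 ≤ 8 * (n * m)} with hA
  have hAm : MeasurableSet A := (measurableSet_boundedBelowOn K c).inter
    (measurableSet_le (by fun_prop) measurable_const)
  have hAc : stdNormal (Fin n × Fin m) Aᶜ ≤ ENNReal.ofReal (1 / 2) := by
    have h2 := stdNormal_le_sum_sq (Fin n × Fin m) (8 * (n * m))
    calc _ ≤ stdNormal (Fin n × Fin m) ((boundedBelowOn m K c)ᶜ ∪ {x | 8 * (n * m) ≤ ∑ i, x i ^ 2}) := by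
          refine measure_mono ?_
          rw [hA, Set.compl_inter]
          refine Set.union_subset_union_right _ fun x hx => ?_
          rw [Set.mem_compl_iff, Set.mem_ofPred_eq, not_le] at hx
          exact hx.le
      _ ≤ _ := measure_union_le _ _
      _ ≤ _ := add_le_add h h2
      _ ≤ _ := by
          rw [← ENNReal.ofReal_add (Real.exp_pos _).le (Real.exp_pos _).le]
          refine ENNReal.ofReal_le_ofReal ?_
          have hm' : (1 : ℝ) ≤ m := by exact_mod_cast hm
          have e1 : Real.exp (-1 : ℝ) ≤ 1 / 2 := by
            rw [Real.exp_neg, one_div]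
            refine inv_anti₀ two_pos ?_
            have := Real.add_one_le_exp (1 : ℝ)
            linarith
          have e2 : Real.exp (-(7 * m : ℝ)) ≤ Real.exp (-1) ^ 3 := by
            rw [← Real.exp_nat_mul]; exact Real.exp_le_exp.2 (by push_cast; linarith)
          have e4 : Real.exp (-(1 / 2 : ℝ)) ≤ 2 / 3 := by
            rw [Real.exp_neg, show (2 / 3 : ℝ) = (3 / 2)⁻¹ by norm_num]
            refine inv_anti₀ (by norm_num) ?_
            have := Real.add_one_le_exp (1 / 2 : ℝ)
            linarith
          have e3 : Real.exp ((Fintype.card (Fin n × Fin m) : ℝ) / 2 - 8 * (n * m) / 4) ≤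
              Real.exp (-1) * Real.exp (-(1 / 2)) := by
            rw [← Real.exp_add]
            refine Real.exp_le_exp.2 ?_
            simp only [Fintype.card_prod, Fintype.card_fin, Nat.cast_mul]
            linarith
          have p1 := Real.exp_pos (-1 : ℝ)
          have p2 := Real.exp_pos (-(1 / 2) : ℝ)
          have q1 : Real.exp (-1 : ℝ) ^ 3 ≤ (1 / 2) ^ 3 := pow_le_pow_left₀ p1.le e1 3
          have q2 : Real.exp (-1 : ℝ) * Real.exp (-(1 / 2)) ≤ 1 / 2 * (2 / 3) :=
            mul_le_mul e1 e4 p2.le (by norm_num)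
          linarith
  have hAp : ENNReal.ofReal (1 / 2) ≤ stdNormal (Fin n × Fin m) A := by
    have := prob_add_prob_compl (μ := stdNormal (Fin n × Fin m)) hAm
    have h1 : (1 : ENNReal) ≤ stdNormal (Fin n × Fin m) A + ENNReal.ofReal (1 / 2) := by
      rw [← this]; gcongr
    have h3 : (1 : ENNReal) = ENNReal.ofReal (1 / 2) + ENNReal.ofReal (1 / 2) := by
      rw [← ENNReal.ofReal_add (by norm_num) (by norm_num)]; norm_num
    rw [h3] at h1
    exact (ENNReal.add_le_add_iff_right ENNReal.ofReal_ne_top).1 h1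
  have hdil := le_stdNormal_dilation hAm ht (r := 8 * (n * m)) fun x hx => hx.2
  calc _ ≤ ENNReal.ofReal (Real.exp (-((t ^ 2 - 1) * (8 * (n * m)) / 2))) * ENNReal.ofReal (1 / 2) := by
        rw [← ENNReal.ofReal_mul (Real.exp_pos _).le]
        refine ENNReal.ofReal_le_ofReal ?_
        rw [mul_comm]
        refine mul_le_mul_of_nonneg_right (Real.exp_le_exp.2 ?_) (by norm_num)
        nlinarith
    _ ≤ _ := mul_le_mul_right hAp _
    _ ≤ _ := hdil
    _ ≤ _ := by
        refine measure_mono fun y hy x hx => ?_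
        have h1 := hy.1 x hx
        have h2 : mat (t⁻¹ • y) = t⁻¹ • mat y := rfl
        rw [h2, Matrix.transpose_smul, map_smul, LinearMap.smul_apply, norm_smul, norm_inv,
          Real.norm_of_nonneg ht0.le, le_inv_mul_iff₀ ht0] at h1
        linarith

lemma stdNormal_map_curry (a : ℕ) (ι : Type*) [Fintype ι] :
    (stdNormal (Fin a × ι)).map (fun G b i => G (b, i)) = Measure.pi fun _ => stdNormal ι := by
  have h := Measure.infinitePi_map_curry (fun (_ : Fin a) (_ : ι) => gaussianReal 0 1)
  simp only [Measure.infinitePi_eq_pi] at h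
  exact h

lemma stdNormal_forall_mem {a : ℕ} {ι : Type*} [Fintype ι] {S : Set (ι → ℝ)}
    (hS : MeasurableSet S) :
    stdNormal (Fin a × ι) {G | ∀ b, (fun i => G (b, i)) ∈ S} = stdNormal ι S ^ a := by
  have h := congrArg (fun μ => μ (Set.univ.pi fun _ : Fin a => S)) (stdNormal_map_curry a ι)
  simp only [Measure.pi_pi, Finset.prod_const, Finset.card_univ, Fintype.card_fin] at h
  rw [← h, Measure.map_apply (by fun_prop) (MeasurableSet.univ_pi fun _ => hS)]
  congr 1
  ext G
  simp [Set.mem_pi]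

lemma stdNormal_mem {a : ℕ} {ι : Type*} [Fintype ι] {S : Set (ι → ℝ)}
    (hS : MeasurableSet S) (b : Fin a) :
    stdNormal (Fin a × ι) {G | (fun i => G (b, i)) ∈ S} = stdNormal ι S := by
  have h := (measurePreserving_eval (fun _ : Fin a => stdNormal ι) b).measure_preimage
    hS.nullMeasurableSet
  rw [← h, ← stdNormal_map_curry, Measure.map_apply (by fun_prop) (measurable_pi_apply b hS)]
  rfl

end ManySketches

/-! ### The selected sketch among arbitrarily many. -/

section AcceptedSketch

open Matrix (toEuclideanLin)

variable {m n k a : ℕ}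

/-- The factor by which the best of `a` Gaussian sketches with `N` entries outgrows a typical
one. -/
noncomputable def growth (N a : ℝ) : ℝ := max 1 √(Real.log a / (8 * N))

lemma one_le_growth (N a : ℝ) : 1 ≤ growth N a := le_max_left _ _

lemma log_le_growth_sq {N a : ℝ} (hN : 0 < N) : Real.log a ≤ 8 * N * growth N a ^ 2 := by
  rcases le_or_gt (Real.log a / (8 * N)) 0 with h | h
  · have : Real.log a ≤ 0 := by
      rw [div_le_iff₀ (by positivity)] at h
      simpa using h
    exact this.trans (by positivity)
  · have h1 : √(Real.log a / (8 * N)) ^ 2 ≤ growth N a ^ 2 :=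
      pow_le_pow_left₀ (Real.sqrt_nonneg _) (le_max_right _ _) 2
    rw [Real.sq_sqrt h.le, div_le_iff₀ (by positivity)] at h1
    linarith

lemma exp_neg_mul_log {x : ℝ} (hx : 0 < x) (j : ℕ) :
    Real.exp (-(j * Real.log x)) = x ^ (-(j : ℤ)) := by
  rw [zpow_neg, zpow_natCast, Real.exp_neg, Real.exp_nat_mul, Real.exp_log hx]

/-- With high probability one of the sketches is well conditioned on `K`, and all of them have
comparable Frobenius norms, however large the number of sketches is. -/
lemma stdNormal_sketch_failure_le {K : Submodule ℝ (EuclideanSpace ℝ (Fin n))}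
    (hK : finrank ℝ K = k) (hn : 2 ≤ n) (hm : 1 ≤ m) {c : ℝ}
    (h : stdNormal (Fin k × Fin m) (boundedBelow k m c)ᶜ ≤ ENNReal.ofReal (Real.exp (-(7 * m))))
    (ha : Real.log n ≤ a * m) :
    stdNormal (Fin a × Fin n × Fin m)
      {G | ¬((∃ b, (fun p => G (b, p)) ∈ boundedBelowOn m K (growth (n * m) a * c)) ∧
        ∀ b, ∑ p, G (b, p) ^ 2 ≤ 64 * (n * m) * growth (n * m) a ^ 2)} ≤
      ENNReal.ofReal ((n : ℝ) ^ (-6 : ℤ)) := by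
  have hn' : (2 : ℝ) ≤ n := by exact_mod_cast hn
  have hm' : (1 : ℝ) ≤ m := by exact_mod_cast hm
  have hnN : (n : ℝ) ≤ n * m := le_mul_of_one_le_right (by positivity) hm'
  set N : ℝ := n * m with hN
  have hN0 : 0 < N := by linarith
  have hlogpos : 0 < Real.log n := Real.log_pos (by linarith)
  have hlogn : Real.log n ≤ n := by
    have := Real.log_le_sub_one_of_pos (show (0 : ℝ) < n by linarith)
    linarith
  have ha0 : 0 < a := by
    rcases Nat.eq_zero_or_pos a with h0 | h0
    · rw [h0] at ha; simp at ha; linarith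
    · exact h0
  have haexp : Real.exp (Real.log a) = a := Real.exp_log (by exact_mod_cast ha0)
  set t := growth N a with ht
  have ht1 : 1 ≤ t := one_le_growth _ _
  have hLt : Real.log a ≤ 8 * N * t ^ 2 := log_le_growth_sq hN0
  have ht2 : 1 ≤ t ^ 2 := one_le_pow₀ ht1
  have hNt : N ≤ N * t ^ 2 := le_mul_of_one_le_right hN0.le ht2
  have hKc := (stdNormal_boundedBelowOn_compl hK c (m := m)).trans h
  set S := boundedBelowOn m K (t * c) with hS
  have hSm : MeasurableSet S := measurableSet_boundedBelowOn K _
  have hcard : (Fintype.card (Fin n × Fin m) : ℝ) = N := by simp [hN]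
  have hfirst : stdNormal (Fin a × Fin n × Fin m) {G | ∀ b, (fun p => G (b, p)) ∈ Sᶜ} ≤
      ENNReal.ofReal (Real.exp (-((7 : ℕ) * Real.log n))) := by
    rw [stdNormal_forall_mem hSm.compl]
    -- With few sketches `t = 1`, and independence gives failure at most `exp (-7 * a * m) ≤ n ^
    -- (-7)`. With many, `t` is tuned so that a single sketch succeeds with probability at least `a
    -- ^ (-1 / 2) / 2`; then `a` trials fail with probability at most `exp (-√a / 2)`, where `√a ≥
    -- exp (4 * n)`.
    rcases le_or_gt (Real.log a) (8 * N) with hsmall | hlarge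
    · have ht' : t = 1 := by
        rw [ht, growth, max_eq_left]
        rw [Real.sqrt_le_one, div_le_one (by positivity)]
        exact hsmall
      rw [hS, ht', one_mul]
      calc _ ≤ ENNReal.ofReal (Real.exp (-(7 * m))) ^ a := by gcongr
        _ = ENNReal.ofReal (Real.exp (a * (-(7 * m)))) := by
            rw [← ENNReal.ofReal_pow (Real.exp_pos _).le, Real.exp_nat_mul]
        _ ≤ _ := by
            refine ENNReal.ofReal_le_ofReal (Real.exp_le_exp.2 ?_)
            push_cast
            linarith
    · have ht' : 8 * N * t ^ 2 = Real.log a := by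
        rw [ht, growth, max_eq_right, Real.sq_sqrt]
        · field_simp
        · exact div_nonneg (by linarith) (by positivity)
        · rw [Real.one_le_sqrt, one_le_div (by positivity)]
          exact hlarge.le
      have hp := stdNormal_boundedBelowOn_scaled (K := K) (by omega) hm hKc ht1
      set q : ℝ := 1 / 2 * Real.exp (-(Real.log a / 2)) with hq
      have hq' : 1 / 2 * Real.exp (-(4 * (n * m) * t ^ 2)) = q := by
        rw [hq, ← ht', hN]; congr 3; ring
      rw [hq'] at hp
      have hcompl : stdNormal (Fin n × Fin m) Sᶜ ≤ ENNReal.ofReal (Real.exp (-q)) := by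
        rw [prob_compl_eq_one_sub hSm]
        refine (tsub_le_tsub_left hp 1).trans ?_
        rw [← ENNReal.ofReal_one, ← ENNReal.ofReal_sub _ (by positivity)]
        refine ENNReal.ofReal_le_ofReal ?_
        have := Real.add_one_le_exp (-q)
        linarith
      calc _ ≤ ENNReal.ofReal (Real.exp (-q)) ^ a := by gcongr
        _ = ENNReal.ofReal (Real.exp (a * -q)) := by
            rw [← ENNReal.ofReal_pow (Real.exp_pos _).le, Real.exp_nat_mul]
        _ ≤ _ := by
            refine ENNReal.ofReal_le_ofReal (Real.exp_le_exp.2 ?_)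
            have e1 : (a : ℝ) * q = 1 / 2 * Real.exp (Real.log a / 2) := by
              rw [hq, ← haexp, mul_left_comm, ← Real.exp_add, haexp]
              congr 2
              ring
            have e2 : Real.exp (4 * n) ≤ Real.exp (Real.log a / 2) :=
              Real.exp_le_exp.2 (by linarith)
            have e3 := Real.quadratic_le_exp_of_nonneg (show (0 : ℝ) ≤ 4 * n by positivity)
            push_cast
            nlinarith
  have hsecond : ∀ b : Fin a, stdNormal (Fin a × Fin n × Fin m)
      {G | (fun p => G (b, p)) ∈ {x : Fin n × Fin m → ℝ | 64 * N * t ^ 2 ≤ ∑ i, x i ^ 2}} ≤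
      ENNReal.ofReal (Real.exp (N / 2 - 16 * N * t ^ 2)) := by
    intro b
    rw [stdNormal_mem (measurableSet_le measurable_const (by fun_prop)) b]
    refine (stdNormal_le_sum_sq _ _).trans (le_of_eq ?_)
    rw [hcard]
    congr 2
    ring
  calc _ ≤ stdNormal (Fin a × Fin n × Fin m) ({G | ∀ b, (fun p => G (b, p)) ∈ Sᶜ} ∪ ⋃ b : Fin a,
        {G | (fun p => G (b, p)) ∈ {x : Fin n × Fin m → ℝ | 64 * N * t ^ 2 ≤ ∑ i, x i ^ 2}}) := by
        refine measure_mono fun G hG => ?_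
        by_contra hcon
        refine hG ⟨?_, fun b => ?_⟩
        · by_contra! hall
          exact hcon (Or.inl hall)
        · by_contra! hlt
          exact hcon (Or.inr (Set.mem_iUnion.2 ⟨b, hlt.le⟩))
    _ ≤ _ := measure_union_le _ _
    _ ≤ ENNReal.ofReal (Real.exp (-((7 : ℕ) * Real.log n))) +
          ENNReal.ofReal (Real.exp (-((7 : ℕ) * Real.log n))) := by
        refine add_le_add hfirst ((measure_iUnion_fintype_le _ _).trans
          ((Finset.sum_le_sum fun b _ => hsecond b).trans ?_))
        rw [Finset.sum_const, Finset.card_univ, Fintype.card_fin, nsmul_eq_mul,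
          ← ENNReal.ofReal_natCast, ← ENNReal.ofReal_mul (Nat.cast_nonneg a)]
        refine ENNReal.ofReal_le_ofReal ?_
        conv_lhs => rw [← haexp]
        rw [← Real.exp_add]
        -- The union bound costs `log a ≤ 8 * N * t ^ 2`, half of the tail exponent `16 * N * t ^
        -- 2`.
        refine Real.exp_le_exp.2 ?_
        push_cast
        linarith
    _ ≤ _ := by
        rw [← ENNReal.ofReal_add (Real.exp_pos _).le (Real.exp_pos _).le]
        refine ENNReal.ofReal_le_ofReal ?_
        rw [exp_neg_mul_log (by linarith)]
        have e1 : (n : ℝ) ^ (-6 : ℤ) = n ^ (-((7 : ℕ) : ℤ)) * n := by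
          rw [← zpow_add_one₀ (by positivity)]; norm_num
        rw [e1]
        have : 0 < (n : ℝ) ^ (-((7 : ℕ) : ℤ)) := by positivity
        nlinarith

lemma norm_mat_le {r : ℝ} (hr : 0 ≤ r) {G : Fin n × Fin m → ℝ} (h : ∑ p, G p ^ 2 ≤ r ^ 2) :
    ‖mat G‖ ≤ r := by
  refine l2_opNorm_le_of_forall _ hr fun x => ?_
  refine abs_le_of_sq_le_sq' ?_ (by positivity) |>.2
  rw [mul_pow, EuclideanSpace.real_norm_sq_eq, EuclideanSpace.real_norm_sq_eq x]
  calc ∑ i, (toEuclideanLin (mat G) x) i ^ 2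
      ≤ ∑ i, (∑ j, G (i, j) ^ 2) * ∑ j, x j ^ 2 := by
        refine Finset.sum_le_sum fun i _ => ?_
        have : (toEuclideanLin (mat G) x) i = ∑ j, G (i, j) * x j := by
          simp [Matrix.toLpLin_apply, Matrix.mulVec, dotProduct, mat]
        rw [this]
        exact Finset.sum_mul_sq_le_sq_mul_sq _ _ _
    _ = (∑ p, G p ^ 2) * ∑ j, x j ^ 2 := by rw [← Finset.sum_mul, ← Fintype.sum_prod_type']
    _ ≤ _ := by gcongr

variable {Ω : Type*} [MeasurableSpace Ω] {μ : Measure Ω} [IsProbabilityMeasure μ]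

/-- The event on which the error bound of the algorithm is derived. -/
theorem holdsWithProb_sketch {M : Matrix (Fin n) (Fin n) ℝ} (hM : M.IsSymm)
    {X : Ω → Matrix (Fin n) (Fin n) ℝ} (hX : IsSymmRandomMatrix X)
    {G : Ω → Fin a → Matrix (Fin n) (Fin m) ℝ} (hG : IsGaussianSketch μ X G) (hk : 1 ≤ k)
    (hr : M.rank = k) (hn : 2 ≤ n) (hm : 1 ≤ m) {e : ℝ} (he : 2 * e < sv M (k - 1))
    (hnoise : 1 - (n : ℝ) ^ (-6 : ℤ) ≤ μ.real {ω | ‖X ω‖ ≤ e}) {c : ℝ} (hc : 0 < c)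
    (h : stdNormal (Fin k × Fin m) (boundedBelow k m c)ᶜ ≤ ENNReal.ofReal (Real.exp (-(7 * m))))
    (ha : Real.log n ≤ a * m) (g : ℕ) :
    HoldsWithProb μ (1 - (n : ℝ) ^ (-5 : ℤ)) fun ω => ‖X ω‖ ≤ e ∧
      (∃ b, (sv M (k - 1) / 2) ^ g * (growth (n * m) a * c) ≤
        sv ((M + X ω) ^ g * G ω b) (k - 1)) ∧
      ∀ b, ‖G ω b‖ ≤ 8 * √(n * m) * growth (n * m) a := by
  obtain ⟨hlaw, hind⟩ := hG
  set t := growth (n * m) a with ht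
  have ht1 : 1 ≤ t := one_le_growth _ _
  set x : Ω → Fin n × Fin n → ℝ := fun ω p => X ω p.1 p.2 with hx
  set y : Ω → Fin a × Fin n × Fin m → ℝ := fun ω q => G ω q.1 q.2.1 q.2.2 with hy
  have hxm : Measurable x := measurable_pi_lambda _ fun p => hX.1 p.1 p.2
  have hym : AEMeasurable y μ := hlaw.aemeasurable
  have hxX : ∀ ω, mat (x ω) = X ω := fun ω => rfl
  have hyG : ∀ ω b, mat (fun p => y ω (b, p)) = G ω b := fun ω b => rfl
  let Good : Set ((Fin n × Fin n → ℝ) × (Fin a × Fin n × Fin m → ℝ)) :=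
    {q | (∃ b, (sv M (k - 1) / 2) ^ g * (t * c) ≤
      sv ((M + mat q.1) ^ g * mat fun p => q.2 (b, p)) (k - 1)) ∧
      ∀ b, ∑ p, q.2 (b, p) ^ 2 ≤ 64 * (n * m) * t ^ 2}
  have hGood : MeasurableSet Good := by
    have h1 : ∀ b : Fin a, Measurable
        fun q : (Fin n × Fin n → ℝ) × (Fin a × Fin n × Fin m → ℝ) =>
          sv ((M + mat q.1) ^ g * mat fun p => q.2 (b, p)) (k - 1) := by
      intro b
      have c1 : Continuous fun q : (Fin n × Fin n → ℝ) × (Fin a × Fin n × Fin m → ℝ) =>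
          (fun p => q.2 (b, p)) := by fun_prop
      have c2 : Continuous fun q : (Fin n × Fin n → ℝ) × (Fin a × Fin n × Fin m → ℝ) =>
          (M + mat q.1) ^ g :=
        (continuous_const.add (continuous_mat.comp continuous_fst)).pow g
      exact ((continuous_sv (k - 1)).comp (c2.matrix_mul (continuous_mat.comp c1))).measurable
    have s1 : MeasurableSet {q : (Fin n × Fin n → ℝ) × (Fin a × Fin n × Fin m → ℝ) |
        ∃ b, (sv M (k - 1) / 2) ^ g * (t * c) ≤
          sv ((M + mat q.1) ^ g * mat fun p => q.2 (b, p)) (k - 1)} := by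
      have : {q : (Fin n × Fin n → ℝ) × (Fin a × Fin n × Fin m → ℝ) |
          ∃ b, (sv M (k - 1) / 2) ^ g * (t * c) ≤
            sv ((M + mat q.1) ^ g * mat fun p => q.2 (b, p)) (k - 1)} =
          ⋃ b, {q | (sv M (k - 1) / 2) ^ g * (t * c) ≤
            sv ((M + mat q.1) ^ g * mat fun p => q.2 (b, p)) (k - 1)} := by
        ext q; simp
      rw [this]
      exact MeasurableSet.iUnion fun b => measurableSet_le measurable_const (h1 b)
    have s2 : MeasurableSet {q : (Fin n × Fin n → ℝ) × (Fin a × Fin n × Fin m → ℝ) |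
        ∀ b, ∑ p, q.2 (b, p) ^ 2 ≤ 64 * (n * m) * t ^ 2} := by
      have : {q : (Fin n × Fin n → ℝ) × (Fin a × Fin n × Fin m → ℝ) |
          ∀ b, ∑ p, q.2 (b, p) ^ 2 ≤ 64 * (n * m) * t ^ 2} =
          ⋂ b, {q | ∑ p, q.2 (b, p) ^ 2 ≤ 64 * (n * m) * t ^ 2} := by
        ext q; simp
      rw [this]
      exact MeasurableSet.iInter fun b => measurableSet_le (by fun_prop) measurable_const
    exact s1.inter s2
  -- Symmetry is recorded because Fubini runs over all arrays `z`, not only over values of `X`.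
  let C : Set (Fin n × Fin n → ℝ) := {z | ‖mat z‖ ≤ e} ∩ {z | (mat z)ᵀ = mat z}
  have hC : MeasurableSet C :=
    ((isClosed_le (continuous_norm.comp continuous_mat) continuous_const).inter
      (isClosed_eq continuous_mat.matrix_transpose continuous_mat)).measurableSet
  have hprod : μ.map (fun ω => (x ω, y ω)) = (μ.map x).prod (stdNormal _) := by
    rw [(indepFun_iff_map_prod_eq_prod_map_map hxm.aemeasurable hym).1 hind, hlaw.map_eq]
  have : IsProbabilityMeasure (μ.map x) := Measure.isProbabilityMeasure_map hxm.aemeasurable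
  have hBad : μ.map (fun ω => (x ω, y ω)) (C ×ˢ Set.univ ∩ Goodᶜ) ≤
      ENNReal.ofReal ((n : ℝ) ^ (-6 : ℤ)) := by
    rw [hprod, Measure.prod_apply ((hC.prod MeasurableSet.univ).inter hGood.compl)]
    calc _ ≤ ∫⁻ _, ENNReal.ofReal ((n : ℝ) ^ (-6 : ℤ)) ∂μ.map x := by
          refine lintegral_mono fun z => ?_
          by_cases hz : z ∈ C
          -- With the noise frozen, `K` is a fixed subspace; by independence the Gaussian estimate
          -- for that subspace applies to the slice.
          · have hTM : (M + mat z).IsSymm := hM.add hz.2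
            obtain ⟨K, hKk, hKs⟩ := exists_submodule_forall_le_sv hTM hk hr
              (by simpa using hz.1 : ‖(M + mat z) - M‖ ≤ e) he g
            refine le_trans (measure_mono fun w hw => ?_)
              (stdNormal_sketch_failure_le hKk hn hm h ha)
            intro hcon
            refine hw.2 ⟨?_, hcon.2⟩
            obtain ⟨b, hb⟩ := hcon.1
            exact ⟨b, hKs m _ _ (by positivity) hb⟩
          · have : Prod.mk z ⁻¹' (C ×ˢ Set.univ ∩ Goodᶜ) = ∅ := by
              ext w; simp [hz]
            rw [this, measure_empty]
            exact zero_le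
      _ = _ := by simp
  have hφ : AEMeasurable (fun ω => (x ω, y ω)) μ := hxm.aemeasurable.prodMk hym
  set A : Set Ω := {ω | ‖X ω‖ ≤ e} ∩ (fun ω => (x ω, y ω)) ⁻¹' Good with hA
  have hE : MeasurableSet {ω | ‖X ω‖ ≤ e} := by
    have h1 : IsClosed {z : Fin n × Fin n → ℝ | ‖mat z‖ ≤ e} :=
      isClosed_le (continuous_norm.comp continuous_mat) continuous_const
    exact hxm h1.measurableSet
  have hAnull : NullMeasurableSet A μ :=
    hE.nullMeasurableSet.inter (hφ.nullMeasurableSet_preimage hGood)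
  have hAc : μ Aᶜ ≤ ENNReal.ofReal ((n : ℝ) ^ (-5 : ℤ)) := by
    have h1 : μ {ω | ‖X ω‖ ≤ e}ᶜ ≤ ENNReal.ofReal ((n : ℝ) ^ (-6 : ℤ)) := by
      rw [ENNReal.le_ofReal_iff_toReal_le (measure_ne_top _ _) (by positivity)]
      have := probReal_compl_eq_one_sub (μ := μ) hE
      rw [measureReal_def] at this
      linarith
    have h2 : μ ((fun ω => (x ω, y ω)) ⁻¹' (C ×ˢ Set.univ ∩ Goodᶜ)) ≤
        ENNReal.ofReal ((n : ℝ) ^ (-6 : ℤ)) := by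
      rwa [Measure.map_apply_of_aemeasurable hφ
        ((hC.prod MeasurableSet.univ).inter hGood.compl)] at hBad
    calc μ Aᶜ ≤ μ ({ω | ‖X ω‖ ≤ e}ᶜ ∪ (fun ω => (x ω, y ω)) ⁻¹' (C ×ˢ Set.univ ∩ Goodᶜ)) := by
          refine measure_mono fun ω hω => ?_
          by_cases hωE : ‖X ω‖ ≤ e
          · exact Or.inr ⟨⟨⟨hωE, hX.2 ω⟩, trivial⟩, fun hg => hω ⟨hωE, hg⟩⟩
          · exact Or.inl hωE
      _ ≤ _ := measure_union_le _ _
      _ ≤ _ := add_le_add h1 h2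
      _ ≤ _ := by
          rw [← ENNReal.ofReal_add (by positivity) (by positivity)]
          refine ENNReal.ofReal_le_ofReal ?_
          have hn' : (2 : ℝ) ≤ n := by exact_mod_cast hn
          have e1 : (n : ℝ) ^ (-5 : ℤ) = n ^ (-6 : ℤ) * n := by
            rw [← zpow_add_one₀ (by positivity)]; norm_num
          rw [e1]
          have : 0 < (n : ℝ) ^ (-6 : ℤ) := by positivity
          nlinarith
  -- The sketches are only almost everywhere measurable, so the event is null measurable and is
  -- replaced by a measurable subset of full mass.
  obtain ⟨A', hA'A, hA'm, hA'eq⟩ := hAnull.exists_measurable_subset_ae_eq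
  refine ⟨A', hA'm, ?_, fun ω hω => ?_⟩
  · have h1 : μ A'ᶜ ≤ ENNReal.ofReal ((n : ℝ) ^ (-5 : ℤ)) := by
      rw [measure_congr hA'eq.compl]; exact hAc
    rw [ENNReal.le_ofReal_iff_toReal_le (measure_ne_top _ _) (by positivity)] at h1
    have := probReal_compl_eq_one_sub (μ := μ) hA'm
    rw [measureReal_def] at this
    linarith
  · obtain ⟨h1, h2, h3⟩ := hA'A hω
    refine ⟨h1, h2, fun b => ?_⟩
    rw [← hyG]
    refine norm_mat_le (by positivity) ((h3 b).trans (le_of_eq ?_))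
    rw [mul_pow, mul_pow, Real.sq_sqrt (by positivity)]
    norm_num

end AcceptedSketch

/-! ### The three growth regimes and the role of the signal-to-noise ratio. -/

section Regimes

lemma EnoughSketches.log_le {kt a : ℕ → ℕ} (h : EnoughSketches 1 kt a)
    (hkt : ∀ᶠ n in atTop, 1 ≤ kt n) : ∀ᶠ n : ℕ in atTop, Real.log n ≤ a n * kt n := by
  filter_upwards [h, hkt] with n hn hk
  have hk' : (0 : ℝ) < kt n := by exact_mod_cast hk
  have h1 : 1 * (kt n : ℝ)⁻¹ * Real.log n ≤ a n := by exact_mod_cast Int.ceil_le.1 hn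
  rwa [one_mul, inv_mul_eq_div, div_le_iff₀ hk'] at h1

/-- The failure rate `exp (-7 * kt)` per sketch is reached in every regime by lowering `δ`, so a
unit constant in the number of sketches suffices. In the second regime the aspect ratio eventually
exceeds `2`. -/
lemma SketchRegime.exists_small_ball {k kt a : ℕ → ℕ}
    (h : SketchRegime (fun _ _ => 1) 1 (fun _ => 1) k kt a)
    (hk : ∀ᶠ n in atTop, 1 ≤ k n ∧ k n ≤ kt n) :
    ∃ δ : ℝ, 0 < δ ∧ ∀ᶠ n : ℕ in atTop, Real.log n ≤ a n * kt n ∧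
      stdNormal (Fin (k n) × Fin (kt n)) (boundedBelow (k n) (kt n) (δ * √(kt n)))ᶜ ≤
        ENNReal.ofReal (Real.exp (-(7 * kt n))) := by
  have hkt : ∀ᶠ n in atTop, 1 ≤ kt n := hk.mono fun n hn => hn.1.trans hn.2
  rcases h with ⟨k₀, kt₀, heq, ha⟩ | ⟨⟨k₀, heq⟩, hlim, ha⟩ | ⟨c, hc, -, hle, ha⟩
  · obtain ⟨n, ⟨h1, h2⟩, h3, h4⟩ := (heq.and hk).exists
    obtain ⟨δ, hδ, hbd⟩ := exists_stdNormal_compl_boundedBelow_le_of_le (k := k₀) (m := kt₀)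
      (by omega) (by omega)
    refine ⟨δ, hδ, ?_⟩
    filter_upwards [ha.log_le hkt, heq] with n hn hn'
    refine ⟨hn, ?_⟩
    rw [hn'.1, hn'.2]
    exact hbd
  · obtain ⟨δ, hδ, hbd⟩ := exists_stdNormal_compl_boundedBelow_le one_lt_two
    refine ⟨δ, hδ, ?_⟩
    filter_upwards [ha.log_le hkt, heq, hkt, hlim.eventually_ge_atTop (2 * k₀)] with n h1 h2 h3 h4
    refine ⟨h1, hbd _ _ h3 ?_⟩
    rw [h2]
    exact_mod_cast h4
  · obtain ⟨δ, hδ, hbd⟩ := exists_stdNormal_compl_boundedBelow_le hc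
    refine ⟨δ, hδ, ?_⟩
    filter_upwards [ha.log_le hkt, hkt, hle] with n h1 h2 h3
    exact ⟨h1, hbd _ _ h2 h3⟩

/-- The error bound of an accepted sketch in terms of the signal-to-noise ratio. -/
lemma error_le {n m g : ℕ} {S σ e ψ c β δ t : ℝ} (hS : 0 < S) (he : 0 < e) (heS : e ≤ S)
    (hσ : 0 < σ) (hψ : 1 ≤ ψ) (hSσ : S ≤ ψ * σ) (hn : 1 ≤ n) (hm : 1 ≤ m) (hδ : 0 < δ)
    (ht : 0 < t) (hβ : 0 < β) (hsnr : (n : ℝ) ^ β ≤ c * (S / e)) (hg : 1 + (2 * β)⁻¹ ≤ (g : ℝ)) :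
    2 * e + 4 * (e ^ g * (8 * √(n * m) * t)) / ((σ / 2) ^ g * (t * (δ * √m))) * (S + e) ≤
      (2 + 64 * 2 ^ g * c ^ (g - 1) / δ) * (ψ ^ g * e) := by
  have hn' : (1 : ℝ) ≤ n := by exact_mod_cast hn
  have hsm : 0 < √(m : ℝ) := Real.sqrt_pos.2 (by exact_mod_cast hm)
  have hβ' : 0 < (2 * β)⁻¹ := by positivity
  obtain ⟨j, rfl⟩ : ∃ j, g = j + 1 := ⟨g - 1, by
    have : 0 < g := by
      have : (0 : ℝ) < g := by linarith
      exact_mod_cast this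
    omega⟩
  have hj : 1 / 2 ≤ β * j := by
    push_cast at hg
    have : (2 * β)⁻¹ ≤ j := by linarith
    rw [inv_le_iff_one_le_mul₀ (by positivity)] at this
    linarith
  have hψg : (1 : ℝ) ≤ ψ ^ (j + 1) := one_le_pow₀ hψ
  -- The condition on `g` is spent here: `j = g - 1` satisfies `β * j ≥ 1 / 2`.
  have hroot : √(n : ℝ) * (e / S) ^ j ≤ c ^ j := by
    have h1 : √(n : ℝ) ≤ ((n : ℝ) ^ β) ^ j := by
      rw [Real.sqrt_eq_rpow, ← Real.rpow_natCast, ← Real.rpow_mul (by positivity)]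
      exact Real.rpow_le_rpow_of_exponent_le hn' hj
    have h2 : (n : ℝ) ^ β * (e / S) ≤ c := by
      calc _ ≤ c * (S / e) * (e / S) := by gcongr
        _ = c := by field_simp
    calc _ ≤ ((n : ℝ) ^ β) ^ j * (e / S) ^ j := by gcongr
      _ = ((n : ℝ) ^ β * (e / S)) ^ j := (mul_pow _ _ _).symm
      _ ≤ _ := by gcongr
  have hratio : (e / σ) ^ (j + 1) * S ≤ ψ ^ (j + 1) * (e * (e / S) ^ j) := by
    have h1 : e / σ ≤ ψ * (e / S) := by
      rw [div_le_iff₀ hσ]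
      calc e = S * (e / S) := by field_simp
        _ ≤ ψ * σ * (e / S) := by gcongr
        _ = _ := by ring
    calc _ ≤ (ψ * (e / S)) ^ (j + 1) * S := by gcongr
      _ = ψ ^ (j + 1) * (e / S * S * (e / S) ^ j) := by rw [mul_pow, pow_succ (e / S)]; ring
      _ = _ := by rw [div_mul_cancel₀ _ hS.ne']
  have hmain : 4 * (e ^ (j + 1) * (8 * √(n * m) * t)) / ((σ / 2) ^ (j + 1) * (t * (δ * √m))) =
      32 * 2 ^ (j + 1) / δ * √n * (e / σ) ^ (j + 1) := by
    rw [Real.sqrt_mul (Nat.cast_nonneg n), div_pow, div_pow]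
    field_simp
    ring
  rw [hmain, Nat.add_sub_cancel]
  calc _ ≤ 2 * e + 32 * 2 ^ (j + 1) / δ * √n * (e / σ) ^ (j + 1) * (2 * S) := by
        gcongr
        linarith
    _ = 2 * e + 64 * 2 ^ (j + 1) / δ * √n * ((e / σ) ^ (j + 1) * S) := by ring
    _ ≤ 2 * e + 64 * 2 ^ (j + 1) / δ * √n * (ψ ^ (j + 1) * (e * (e / S) ^ j)) := by gcongr
    _ = 2 * e + 64 * 2 ^ (j + 1) / δ * (√n * (e / S) ^ j) * (ψ ^ (j + 1) * e) := by ring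
    _ ≤ 2 * (ψ ^ (j + 1) * e) + 64 * 2 ^ (j + 1) / δ * c ^ j * (ψ ^ (j + 1) * e) := by
        gcongr
        exact le_mul_of_one_le_left he.le hψg
    _ = _ := by ring

end Regimes

end RSVD

/-! ### Assembly. -/

theorem corollary1 :
    ∃ (Ca : ℕ → ℕ → ℝ) (Cb : ℝ) (Cc : ℝ → ℝ),
      (∀ k₀ kt₀, 0 < Ca k₀ kt₀) ∧ (0 < Cb ∧ Cb ≤ 15) ∧
      (∀ c, 1 < c → 0 < Cc c) ∧ AntitoneOn Cc (Set.Ioi 1) ∧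
      ∀ (Ω : ℕ → Type*) [∀ n, MeasurableSpace (Ω n)]
        (μ : ∀ n, Measure (Ω n)) [∀ n, IsProbabilityMeasure (μ n)]
        (M : ∀ n, Matrix (Fin n) (Fin n) ℝ) (E : ∀ n, Ω n → Matrix (Fin n) (Fin n) ℝ)
        (En : ℕ → ℝ) (β : ℝ) (k kt a : ℕ → ℕ) (g : ℕ)
        (G : ∀ n, Ω n → Fin (a n) → Matrix (Fin n) (Fin (kt n)) ℝ),
        (∀ n, (M n).IsSymm) →
        (∀ n, RSVD.IsSymmRandomMatrix (E n)) →
        (∀ᶠ n in atTop, (M n).rank = k n ∧ 1 ≤ k n ∧ k n ≤ kt n) →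
        RSVD.SNRAssumption μ M E En β →
        (∀ n, RSVD.IsGaussianSketch (μ n) (E n) (G n)) →
        RSVD.SketchRegime Ca Cb Cc k kt a →
        (fun n => RSVD.condNumber (M n)) =o[atTop] (fun n => ‖M n‖ / En n) →
        1 + (2 * β)⁻¹ ≤ (g : ℝ) →
        ∃ K : ℝ, ∀ᶠ n : ℕ in atTop,
          RSVD.HoldsWithProb (μ n) (1 - (n : ℝ) ^ (-5 : ℤ)) (fun ω =>
            ∀ (U : Matrix (Fin n) (Fin (k n)) ℝ) (σ : Fin (k n) → ℝ),
              RSVD.IsRSVDOutput g (M n + E n ω) (G n ω) U σ →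
              ∀ l : Fin (k n), |σ l - RSVD.sv (M n) l| ≤
                K * (RSVD.theta (kt n) n * RSVD.condNumber (M n) ^ g * En n)) := by
  -- The dependence on the regime is carried by `δ`, hence by `K`, and not by the sketch constants.
  refine ⟨fun _ _ => 1, 1, fun _ => 1, fun _ _ => one_pos, ⟨one_pos, by norm_num⟩,
    fun _ _ => one_pos, fun _ _ _ _ _ => le_rfl, ?_⟩
  intro Ω _ μ _ M E En β k kt a g G hM hE hrank hsnr hG hreg hψ hg
  obtain ⟨δ, hδ, hsmall⟩ := hreg.exists_small_ball (hrank.mono fun n hn => hn.2)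
  obtain ⟨c, hc⟩ := hsnr.snr
  refine ⟨2 + 64 * 2 ^ g * c ^ (g - 1) / δ, ?_⟩
  -- The value `1 / 4` together with `‖M‖ ≤ ψ * σ_k` gives noise at most `σ_k / 4`, hence the strict
  -- gap `2 * e < σ_k`.
  filter_upwards [hrank, hsmall, hc, hsnr.noise_pos, hsnr.noise, hψ.bound (c := 1 / 4) (by norm_num),
    eventually_ge_atTop 2] with n ⟨hr, hk, hkt⟩ ⟨ha, hbd⟩ hcn he hnoise hψn hn
  have hm : 1 ≤ kt n := hk.trans hkt
  have hσ : 0 < RSVD.sv (M n) (k n - 1) := RSVD.sv_pos_of_lt_rank _ (by omega)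
  have hS : 0 < ‖M n‖ := hσ.trans_le (RSVD.sv_le_norm _ _)
  have hψ1 := RSVD.one_le_condNumber (hM n) hk hr
  have hSσ := RSVD.norm_le_condNumber_mul (hM n) hk hr
  rw [Real.norm_of_nonneg (by linarith), Real.norm_of_nonneg (by positivity),
    mul_div_assoc', le_div_iff₀ he] at hψn
  have heS : En n ≤ ‖M n‖ / 4 := by nlinarith
  have heσ : En n ≤ RSVD.sv (M n) (k n - 1) / 4 := by
    have : RSVD.condNumber (M n) * En n ≤
        RSVD.condNumber (M n) * (RSVD.sv (M n) (k n - 1) / 4) := by linarith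
    exact le_of_mul_le_mul_left this (by linarith)
  have hsm : 0 < √(kt n : ℝ) := Real.sqrt_pos.2 (by exact_mod_cast hm)
  set t := RSVD.growth (n * kt n) (a n)
  have ht : 0 < t := one_pos.trans_le (RSVD.one_le_growth _ _)
  obtain ⟨A, hAm, hAp, hA⟩ := RSVD.holdsWithProb_sketch (hM n) (hE n) (hG n) hk hr hn hm
    (by linarith : 2 * En n < _) hnoise (mul_pos hδ hsm) hbd ha g
  refine ⟨A, hAm, hAp, fun ω hω U σ hout l => ?_⟩
  obtain ⟨hEn, ⟨b, hb⟩, hB⟩ := hA ω hω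
  obtain ⟨b', hmax, hU, hσU⟩ := hout
  rw [hσU l]
  refine (RSVD.abs_sv_sub_sv_le ((hM n).add ((hE n).2 ω)) hk hr (by simpa using hEn)
    (by linarith) (hB b') (by positivity) (hb.trans (hmax b)) hU l).trans
    ((RSVD.error_le hS he (by linarith) hσ hψ1 hSσ (by omega) hm hδ ht hsnr.beta_pos hcn hg).trans ?_)
  have hc0 : 0 ≤ c := by
    by_contra! hneg
    have h1 : (0 : ℝ) < (n : ℝ) ^ β := by positivity
    have h2 : c * (‖M n‖ / En n) ≤ 0 := mul_nonpos_of_nonpos_of_nonneg hneg.le (by positivity)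
    linarith
  refine mul_le_mul_of_nonneg_left ?_ (by positivity)
  have hθ : 1 ≤ RSVD.theta (kt n) n := le_max_left _ _
  rw [mul_assoc]
  exact le_mul_of_one_le_left (by positivity) hθ
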